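/- Let $M$ be a closed (compact, without boundary) smooth surface with a smooth Riemannian metric $g_0$ of constant scalar curvature $R_0$ and unit volume. Undecorated $|\cdot|$, $\Delta$ (the Laplace–Beltrami operator) and $dV$ refer to $g_0$; norms of tensors are full tensor norms, so $|F|^2=g_0^{ik}g_0^{jl}F_{ij}F_{kl}$. Let $L\to M$ be a smooth principal $U(1)$-bundle. For a connection $A$ on $L$ let $F$ denote its curvature, regarded as a real two-form (locally $F=dA$). For a function $u$ and a connection $A$ set $$\mathcal F(u,A)=\int_M\left(|du|^2+e^{-u}|F|^2\right)dV+2R_0\int_M u\,dV .$$ Let $J\subset[0,\infty)$ be an interval with more than one point and least element $0$, and let $u(t)$ be functions on $M$ and $A(t)$ connections on $L$, $t\in J$, smooth on $J\times M$. Write $g=g(t)=e^{u(t)}g_0$ and $F=F(t)$ for the curvature of $A(t)$, and suppose that $\partial_tA=-d^*_{g}F$, where $(d^*_gF)_j=-g^{ik}\nabla^g_iF_{kj}$, and that either (a) (conformal Ricci Yang–Mills flow) $$u_t=e^{-u}\left(\Delta u-R_0+\tfrac12e^{-u}|F|^2\right),\quad\text{or}$$ (b) (volume-normalized flow) $$u_t=e^{-u}\Delta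 u+R_0(1-e^{-u})+\tfrac12\left(e^{-2u}|F|^2-\frac{\int_Me^{-u}|F|^2\,dV}{\int_Me^u\,dV}\right),$$ and, if $R_0\neq0$, the initial metric $g(0)$ has unit volume, i.e. $\int_Me^{u(0)}\,dV=1$. Then for every $t\in J$ (with one-sided derivatives at endpoints of $J$) $$\frac{d}{dt}\mathcal F(u(t),A(t))=-2\int_Me^u|u_t|^2\,dV-2\int_M|\nabla^gF|_g^2\,dV_g .$$ In particular $t\mapsto\mathcal F(u(t),A(t))$ is nonincreasing on $J$, so $\mathcal F(u(t),A(t))\le\mathcal F(u(0),A(0))$. -/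

import Mathlib

open Bundle Set MeasureTheory
open scoped Manifold ContDiff

noncomputable section

namespace RYM

/-! ### Tensor calculus on a smooth surface, in the coordinates of the charts of its atlas -/

section Tensors

variable {M : Type*} [TopologicalSpace M] [ChartedSpace (EuclideanSpace ℝ (Fin 2)) M]

/-- Covariant 2-tensor fields, written as families of real functions of two tangent vectors.
Metrics `g` and two-forms `F` are regarded as such fields. -/
abbrev TensorField₂ (M : Type*) [TopologicalSpace M]
    [ChartedSpace (EuclideanSpace ℝ (Fin 2)) M] : Type _ :=
  ∀ x : M, TangentSpace (𝓡 2) x → TangentSpace (𝓡 2) x → ℝ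

/-- The `i`-th partial derivative of `f` at `x`, in the chart of the atlas around `c`. -/
def pd (c : M) (i : Fin 2) (f : M → ℝ) (x : M) : ℝ :=
  fderiv ℝ (fun y => f ((extChartAt (𝓡 2) c).symm y)) (extChartAt (𝓡 2) c x)
    (EuclideanSpace.single i 1)

variable [IsManifold (𝓡 2) ∞ M]

/-- The coordinate vector field `∂ᵢ` of the chart around `c` (meaningful on the source of that
chart): the inverse of the differential of the chart applied to the `i`-th standard vector. -/
def coordFrame (c : M) (i : Fin 2) (x : M) : TangentSpace (𝓡 2) x :=
  (trivializationAt (EuclideanSpace ℝ (Fin 2)) (TangentSpace (𝓡 2)) c).symmL ℝ x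
    (EuclideanSpace.single i 1)

/-- The `i`-th component of the tangent vector `v` at `x` in the chart around `c`. -/
def coord (c : M) (i : Fin 2) (x : M) (v : TangentSpace (𝓡 2) x) : ℝ :=
  ((trivializationAt (EuclideanSpace ℝ (Fin 2)) (TangentSpace (𝓡 2)) c).continuousLinearMapAt
    ℝ x v) i

/-- The components `b_{ij}` of a 2-tensor field in the chart around `c`. -/
def comp (b : TensorField₂ M) (c : M) (i j : Fin 2) (x : M) : ℝ :=
  b x (coordFrame c i x) (coordFrame c j x)

/-- The Gram matrix `(g_{ij})` in the chart around `c`. -/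
def gram (g : TensorField₂ M) (c x : M) : Matrix (Fin 2) (Fin 2) ℝ :=
  Matrix.of fun i j => comp g c i j x

/-- The components `g^{ij}` of the inverse metric in the chart around `c`. -/
def gInv (g : TensorField₂ M) (c : M) (i j : Fin 2) (x : M) : ℝ :=
  (gram g c x)⁻¹ i j

/-- The Christoffel symbols `Γ^k_{ij}` of the Levi-Civita connection of `g` in the chart
around `c`. -/
def christoffel (g : TensorField₂ M) (c : M) (k i j : Fin 2) (x : M) : ℝ :=
  (1 / 2) * ∑ l, gInv g c k l x *
    (pd c i (comp g c j l) x + pd c j (comp g c i l) x - pd c l (comp g c i j) x)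

/-- The Ricci tensor `R_{jk}` of `g` in the chart around `c`. -/
def ricci (g : TensorField₂ M) (c : M) (j k : Fin 2) (x : M) : ℝ :=
  ∑ i, (pd c i (christoffel g c i j k) x - pd c j (christoffel g c i i k) x) +
    ∑ i, ∑ m, (christoffel g c i i m x * christoffel g c m j k x -
      christoffel g c i j m x * christoffel g c m i k x)

/-- The scalar curvature (twice the Gauss curvature). -/
def scalarCurvature (g : TensorField₂ M) (x : M) : ℝ :=
  ∑ j, ∑ k, gInv g x j k x * ricci g x j k x

/-- The Laplace-Beltrami operator `Δ f = (det g)^{-1/2} ∂ᵢ((det g)^{1/2} g^{ij} ∂ⱼ f)`. -/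
def laplacian (g : TensorField₂ M) (f : M → ℝ) (x : M) : ℝ :=
  (Real.sqrt (gram g x x).det)⁻¹ * ∑ i, pd x i
    (fun y => Real.sqrt (gram g x y).det * ∑ j, gInv g x i j y * pd x j f y) x

/-- `|df|²_g`. -/
def dNormSq (g : TensorField₂ M) (f : M → ℝ) (x : M) : ℝ :=
  ∑ i, ∑ j, gInv g x i j x * pd x i f x * pd x j f x

/-- `|F|²_g = g^{ik} g^{jl} F_{ij} F_{kl}`, summed over all indices. -/
def normSq (g F : TensorField₂ M) (x : M) : ℝ :=
  ∑ i, ∑ j, ∑ k, ∑ l, gInv g x i k x * gInv g x j l x * comp F x i j x * comp F x k l x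

/-- The components `∇_k F_{ij}` of the Levi-Civita covariant derivative of `F` with respect to
`g`, in the chart around `c`. -/
def nabla (g F : TensorField₂ M) (c : M) (k i j : Fin 2) (x : M) : ℝ :=
  pd c k (comp F c i j) x - ∑ l, christoffel g c l k i x * comp F c l j x -
    ∑ l, christoffel g c l k j x * comp F c i l x

/-- `|∇^g F|²_g`. -/
def nablaNormSq (g F : TensorField₂ M) (x : M) : ℝ :=
  ∑ k, ∑ i, ∑ j, ∑ k', ∑ i', ∑ j', gInv g x k k' x * gInv g x i i' x * gInv g x j j' x *
    nabla g F x k i j x * nabla g F x k' i' j' x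

/-- The codifferential `(d^* F)_j = - g^{ik} ∇_i F_{kj}` of a two-form, as a one-form. -/
def codiff (g F : TensorField₂ M) (x : M) (v : TangentSpace (𝓡 2) x) : ℝ :=
  ∑ j, (-∑ i, ∑ k, gInv g x i k x * nabla g F x i k j x) * coord x j x v

/-- The exterior derivative of a one-form: `(dα)_{kl} = ∂_k α_l - ∂_l α_k`. -/
def extD (α : ∀ x : M, TangentSpace (𝓡 2) x → ℝ) : TensorField₂ M := fun x v w =>
  ∑ k, ∑ l, (pd x k (fun y => α y (coordFrame x l y)) x -
    pd x l (fun y => α y (coordFrame x k y)) x) * coord x k x v * coord x l x w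

/-- The measure with density `(det g)^{1/2}` on (the source of) the chart around `c`, extended
by zero. -/
def chartVolume [MeasurableSpace M] (g : TensorField₂ M) (c : M) : Measure M :=
  ((volume.restrict (extChartAt (𝓡 2) c).target).withDensity fun y =>
    ENNReal.ofReal (Real.sqrt (gram g c ((extChartAt (𝓡 2) c).symm y)).det)).map
      (extChartAt (𝓡 2) c).symm

/-- The Riemannian volume measure `dV_g`: the least measure that is at least `(det g)^{1/2} dy`
on every chart. As these chart measures agree on overlaps, it is the measure that restricts to
each of them. -/
def riemVolume [MeasurableSpace M] (g : TensorField₂ M) : Measure M :=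
  ⨆ c : M, chartVolume g c

/-- The conformal metric `e^u g`. -/
def conformal (u : M → ℝ) (g : TensorField₂ M) : TensorField₂ M :=
  fun x v w => Real.exp (u x) * g x v w

/-- A smooth Riemannian metric on `M`, regarded as a covariant 2-tensor field. -/
def ofMetric (g : ContMDiffRiemannianMetric (𝓡 2) ∞ (EuclideanSpace ℝ (Fin 2))
    (fun x : M => TangentSpace (𝓡 2) x)) : TensorField₂ M :=
  fun x v w => g.inner x v w

end Tensors

/-! ### `U(1)`-bundles, connections and curvature -/

section Bundles

/-- A smooth principal `U(1)`-bundle over `M`, given by an open cover that trivializes it and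
smooth transition functions: the local sections satisfy `s_j = s_i τ_{ij}`. -/
structure U1Bundle (ι M : Type*) [TopologicalSpace M]
    [ChartedSpace (EuclideanSpace ℝ (Fin 2)) M] where
  baseSet : ι → Set M
  isOpen_baseSet : ∀ i, IsOpen (baseSet i)
  indexAt : M → ι
  mem_baseSet_at : ∀ x, x ∈ baseSet (indexAt x)
  transition : ι → ι → M → Circle
  contMDiffOn_transition : ∀ i j, ContMDiffOn (𝓡 2) 𝓘(ℝ, ℂ) ∞
    (fun x => (transition i j x : ℂ)) (baseSet i ∩ baseSet j)
  transition_mul : ∀ i j k, ∀ x ∈ baseSet i ∩ baseSet j ∩ baseSet k,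
    transition i j x * transition j k x = transition i k x

variable {ι M : Type*} [TopologicalSpace M] [ChartedSpace (EuclideanSpace ℝ (Fin 2)) M]
  [IsManifold (𝓡 2) ∞ M]

/-- The differential `dτ_{ij}` of a transition function, with values in `ℂ`. -/
def U1Bundle.dTransition (L : U1Bundle ι M) (i j : ι) (x : M) (v : TangentSpace (𝓡 2) x) : ℂ :=
  mfderiv (𝓡 2) 𝓘(ℝ, ℂ) (fun y => (L.transition i j y : ℂ)) x v

/-- A smooth connection on a `U(1)`-bundle. The Lie algebra of `U(1)` is `√-1 ℝ`; the connection
form in the `i`-th trivialization is `√-1 A_i` with a real one-form `A_i`, and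
`√-1 A_j = √-1 A_i + τ_{ij}^{-1} dτ_{ij}` on overlaps. -/
structure Connection (L : U1Bundle ι M) where
  form : ι → ∀ x : M, TangentSpace (𝓡 2) x →L[ℝ] ℝ
  smooth_form : ∀ i (c : M) (k : Fin 2), ContMDiffOn (𝓡 2) 𝓘(ℝ, ℝ) ∞
    (fun x => form i x (coordFrame c k x))
    (L.baseSet i ∩ (chartAt (EuclideanSpace ℝ (Fin 2)) c).source)
  form_transition : ∀ i j, ∀ x ∈ L.baseSet i ∩ L.baseSet j, ∀ v : TangentSpace (𝓡 2) x,
    form j x v = form i x v +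
      (star (L.transition i j x : ℂ) * L.dTransition i j x v).im

/-- The curvature of a connection, as a real two-form: `F = dA_i` on the `i`-th trivializing
set. -/
def Connection.curvature {L : U1Bundle ι M} (A : Connection L) : TensorField₂ M := fun x =>
  extD (fun y v => A.form (L.indexAt x) y v) x

/-- A time-dependent connection `A(t)`, `t ∈ J`, is smooth in space and time. -/
def SmoothFamily {L : U1Bundle ι M} (J : Set ℝ) (A : ℝ → Connection L) : Prop :=
  ∀ i (c : M) (k : Fin 2), ContMDiffOn (𝓘(ℝ, ℝ).prod (𝓡 2)) 𝓘(ℝ, ℝ) ∞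
    (fun p : ℝ × M => (A p.1).form i p.2 (coordFrame c k p.2))
    (J ×ˢ (L.baseSet i ∩ (chartAt (EuclideanSpace ℝ (Fin 2)) c).source))

/-! ### The flows and the energy -/

/-- The equation `∂A/∂t = - d^*_{g(t)} F(t)` with `g(t) = e^{u(t)} g₀`, for `t ∈ J`. -/
def ConnectionFlow {L : U1Bundle ι M} (g₀ : TensorField₂ M) (J : Set ℝ) (u : ℝ → M → ℝ)
    (A : ℝ → Connection L) : Prop :=
  ∀ t ∈ J, ∀ i, ∀ x ∈ L.baseSet i, ∀ v : TangentSpace (𝓡 2) x,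
    HasDerivWithinAt (fun s => (A s).form i x v)
      (-codiff (conformal (u t) g₀) (A t).curvature x v) J t

/-- `(u(t), A(t))`, `t ∈ J`, solves the Ricci Yang-Mills flow in conformal form. -/
def IsConformalRYMFlow {L : U1Bundle ι M} (g₀ : TensorField₂ M) (R₀ : ℝ) (J : Set ℝ)
    (u : ℝ → M → ℝ) (A : ℝ → Connection L) : Prop :=
  (∀ t ∈ J, ∀ x, HasDerivWithinAt (fun s => u s x)
    (Real.exp (-u t x) * (laplacian g₀ (u t) x - R₀ +
      (1 / 2) * Real.exp (-u t x) * normSq g₀ (A t).curvature x)) J t) ∧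
  ConnectionFlow g₀ J u A

variable [MeasurableSpace M]

/-- `(u(t), A(t))`, `t ∈ J`, solves the volume-normalized system. -/
def IsVolumeNormalizedRYMFlow {L : U1Bundle ι M} (g₀ : TensorField₂ M) (R₀ : ℝ) (J : Set ℝ)
    (u : ℝ → M → ℝ) (A : ℝ → Connection L) : Prop :=
  (∀ t ∈ J, ∀ x, HasDerivWithinAt (fun s => u s x)
    (Real.exp (-u t x) * laplacian g₀ (u t) x + R₀ * (1 - Real.exp (-u t x)) +
      (1 / 2) * (Real.exp (-2 * u t x) * normSq g₀ (A t).curvature x -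
        (∫ y, Real.exp (-u t y) * normSq g₀ (A t).curvature y ∂riemVolume g₀) /
          ∫ y, Real.exp (u t y) ∂riemVolume g₀)) J t) ∧
  ConnectionFlow g₀ J u A

/-- The functional `𝓕(u, A) = ∫ (|du|² + e^{-u} |F|²) dV + 2 R₀ ∫ u dV`. -/
def energy {L : U1Bundle ι M} (g₀ : TensorField₂ M) (R₀ : ℝ) (u : M → ℝ)
    (A : Connection L) : ℝ :=
  (∫ x, (dNormSq g₀ u x + Real.exp (-u x) * normSq g₀ A.curvature x) ∂riemVolume g₀) +
    2 * R₀ * ∫ x, u x ∂riemVolume g₀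

end Bundles

end RYM

end

/-!
# Monotonicity of the energy along the conformal Ricci Yang-Mills flows

On a surface every two-form is a function times the volume form. Write `F = f dV_g` for
`g = e^u g₀`, in a chart (`density`; `f` is defined up to the sign given by the orientation of the
chart, `f²` is global). The Levi-Civita connection annihilates `dV_g`, hence `∇F = df ⊗ dV_g`
(`nabla_eq`), `|∇F|² = 2 |df|²` (`nablaNormSq_eq`) and `-d^*F = ⋆df` (`neg_codiff_eq`,
`IsTwoForm.neg_codiff`). The Hodge star on one-forms is conformally invariant
(`starForm_conformal`) and `d ⋆ df = Δf dV₀` (`curl_starForm`), so the flow `∂ₜA = -d^*F` becomes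
`∂ₜF = Δf dV₀` with the fixed Laplacian of `g₀` (`hasDerivWithinAt_comp_curvature`). As
`e^{-2u} |F|² = 2 f²`, and `e^u |∇F|²_g = 2 |df|²` with the norm of `g₀` on the right, this gives
`∂ₜ(e^{-u} |F|²) = -uₜ e^{-u} |F|² + Δ(e^{-2u} |F|²) - 2 e^u |∇F|²_g`
(`hasDerivWithinAt_exp_mul_normSq`). The middle term integrates to zero, and Green's identity
(`integral_mul_laplacian`) turns `∂ₜ |du|² = 2 ⟨duₜ, du⟩` into `-2 uₜ Δu`. Hence, for any `uₜ`,
`d𝓕/dt = -2 ∫ uₜ (Δu - R₀ + e^{-u} |F|² / 2) dV - 2 ∫ |∇F|²_g dV_g` (`hasDerivWithinAt_energy`).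
For the conformal flow the bracket is `e^u uₜ`. For the volume-normalized flow it differs from
`e^u uₜ` by a multiple of `e^u` that is constant in space, which does not contribute because the
volume `V = ∫ e^u dV` is stationary: `V' = R₀ (V - 1)`
(`integral_exp_mul_derivWithin_eq_zero`).

The differential operators in the statement are computed at each point in the chart around that
point, so integrating by parts needs their invariance under changes of charts. All of it is reduced
to the naturality of the exterior derivative of one-forms (`curl_change`). The Riemannian volume is
handled through `riemVolume_restrict`: it restricts to `(det g)^{1/2} dy` in each chart.
-/

set_option linter.unusedSectionVars false

noncomputable section

namespace RYM

open Filter Topology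

local notation "𝔼" => EuclideanSpace ℝ (Fin 2)

/-! ### Partial derivatives of functions on a time interval times an open set -/

section Euclidean

lemma two_le_infty : (2 : ℕ∞ω) ≤ ∞ := WithTop.coe_le_coe.2 (le_top : (2 : ℕ∞) ≤ ⊤)

variable {E : Type*} [NormedAddCommGroup E] [NormedSpace ℝ E] {J : Set ℝ} {O : Set E}
  {W : ℝ → E → ℝ}

lemma fderivWithin_prod_space (hO : IsOpen O)
    {n : ℕ∞ω} (hn : n ≠ 0) (hW : ContDiffOn ℝ n (fun p : ℝ × E => W p.1 p.2) (J ×ˢ O))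
    {t : ℝ} (ht : t ∈ J) {y : E} (hy : y ∈ O) (e : E) :
    fderiv ℝ (W t) y e =
      fderivWithin ℝ (fun p : ℝ × E => W p.1 p.2) (J ×ˢ O) (t, y) (0, e) := by
  have h1 : HasFDerivWithinAt (fun p : ℝ × E => W p.1 p.2)
      (fderivWithin ℝ (fun p : ℝ × E => W p.1 p.2) (J ×ˢ O) (t, y)) (J ×ˢ O) (t, y) :=
    ((hW (t, y) ⟨ht, hy⟩).differentiableWithinAt hn).hasFDerivWithinAt
  have h2 : HasFDerivWithinAt (fun z : E => (t, z)) (ContinuousLinearMap.inr ℝ ℝ E) O y :=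
    (hasFDerivAt_prodMk_right t y).hasFDerivWithinAt
  have h3 := HasFDerivWithinAt.comp y h1 h2 (fun z hz => ⟨ht, hz⟩)
  have h4 := (h3.hasFDerivAt (hO.mem_nhds hy)).fderiv
  have h5 : (fun p : ℝ × E => W p.1 p.2) ∘ (fun z : E => (t, z)) = W t := rfl
  rw [h5] at h4
  rw [h4]; simp

lemma hasDerivWithinAt_prod_time {n : ℕ∞ω} (hn : n ≠ 0)
    (hW : ContDiffOn ℝ n (fun p : ℝ × E => W p.1 p.2) (J ×ˢ O))
    {t : ℝ} (ht : t ∈ J) {y : E} (hy : y ∈ O) :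
    HasDerivWithinAt (fun s => W s y)
      (fderivWithin ℝ (fun p : ℝ × E => W p.1 p.2) (J ×ˢ O) (t, y) (1, 0)) J t := by
  have h1 : HasFDerivWithinAt (fun p : ℝ × E => W p.1 p.2)
      (fderivWithin ℝ (fun p : ℝ × E => W p.1 p.2) (J ×ˢ O) (t, y)) (J ×ˢ O) (t, y) :=
    ((hW (t, y) ⟨ht, hy⟩).differentiableWithinAt hn).hasFDerivWithinAt
  have h2 : HasFDerivWithinAt (fun s : ℝ => (s, y)) (ContinuousLinearMap.inl ℝ ℝ E) J t :=
    (hasFDerivAt_prodMk_left t y).hasFDerivWithinAt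
  have h3 := (HasFDerivWithinAt.comp t h1 h2
    (show MapsTo (fun s : ℝ => (s, y)) J (J ×ˢ O) from fun z hz => ⟨hz, hy⟩)).hasDerivWithinAt
  simp only [ContinuousLinearMap.comp_apply, ContinuousLinearMap.inl_apply] at h3
  exact h3

lemma contDiffOn_fderiv_space (hJ : UniqueDiffOn ℝ J) (hO : IsOpen O)
    (hW : ContDiffOn ℝ ∞ (fun p : ℝ × E => W p.1 p.2) (J ×ˢ O)) (e : E) :
    ContDiffOn ℝ ∞ (fun p : ℝ × E => fderiv ℝ (W p.1) p.2 e) (J ×ˢ O) := by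
  have h := (hW.fderivWithin (hJ.prod hO.uniqueDiffOn) (m := ∞) (by simp)).clm_apply
    (contDiffOn_const (c := ((0, e) : ℝ × E)))
  exact h.congr fun p hp => fderivWithin_prod_space hO (by simp) hW hp.1 hp.2 e

lemma contDiffOn_derivWithin_time (hJ : UniqueDiffOn ℝ J) (hO : IsOpen O)
    (hW : ContDiffOn ℝ ∞ (fun p : ℝ × E => W p.1 p.2) (J ×ˢ O)) :
    ContDiffOn ℝ ∞ (fun p : ℝ × E => derivWithin (fun s => W s p.2) J p.1) (J ×ˢ O) := by
  have h := (hW.fderivWithin (hJ.prod hO.uniqueDiffOn) (m := ∞) (by simp)).clm_apply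
    (contDiffOn_const (c := ((1, 0) : ℝ × E)))
  exact h.congr fun p hp =>
    (hasDerivWithinAt_prod_time (by simp) hW hp.1 hp.2).derivWithin (hJ p.1 hp.1)

/-- The mixed derivatives in time and space commute, up to the boundary of the time interval. -/
lemma hasDerivWithinAt_fderiv_space (hJ : UniqueDiffOn ℝ J) (hJ' : J ⊆ closure (interior J))
    (hO : IsOpen O)
    (hW : ContDiffOn ℝ ∞ (fun p : ℝ × E => W p.1 p.2) (J ×ˢ O)) (e : E)
    {t : ℝ} (ht : t ∈ J) {y : E} (hy : y ∈ O) :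
    HasDerivWithinAt (fun s => fderiv ℝ (W s) y e)
      (fderiv ℝ (fun z => derivWithin (fun s => W s z) J t) y e) J t := by
  set S := J ×ˢ O
  have hS : UniqueDiffOn ℝ S := hJ.prod hO.uniqueDiffOn
  set f := fun p : ℝ × E => W p.1 p.2
  have hf' := hW.fderivWithin hS (m := ∞) (by simp)
  have hd : HasFDerivWithinAt (fderivWithin ℝ f S)
      (fderivWithin ℝ (fderivWithin ℝ f S) S (t, y)) S (t, y) :=
    ((hf' (t, y) ⟨ht, hy⟩).differentiableWithinAt (by simp)).hasFDerivWithinAt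
  have hsymm : IsSymmSndFDerivWithinAt ℝ f S (t, y) := by
    refine (hW (t, y) ⟨ht, hy⟩).isSymmSndFDerivWithinAt ?_ hS ?_ ⟨ht, hy⟩
    · rw [minSmoothness_of_isRCLikeNormedField]; exact two_le_infty
    · rw [interior_prod_eq, closure_prod_eq, hO.interior_eq]
      exact ⟨hJ' ht, subset_closure hy⟩
  have key : ∀ a : ℝ × E, HasFDerivWithinAt (fun p => fderivWithin ℝ f S p a)
      ((fderivWithin ℝ (fderivWithin ℝ f S) S (t, y)).flip a) S (t, y) := fun a =>
    hd.clm_apply (hasFDerivWithinAt_const a _ _) |>.congr_fderiv (by ext <;> simp)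
  have h1 : HasDerivWithinAt (fun s => fderivWithin ℝ f S (s, y) (0, e))
      (fderivWithin ℝ (fderivWithin ℝ f S) S (t, y) (1, 0) (0, e)) J t := by
    have h2 : HasFDerivWithinAt (fun s : ℝ => (s, y)) (ContinuousLinearMap.inl ℝ ℝ E) J t :=
      (hasFDerivAt_prodMk_left t y).hasFDerivWithinAt
    have h3 := (HasFDerivWithinAt.comp t (key (0, e)) h2
      (show MapsTo (fun s : ℝ => (s, y)) J S from fun z hz => ⟨hz, hy⟩)).hasDerivWithinAt
    simp only [ContinuousLinearMap.comp_apply, ContinuousLinearMap.inl_apply,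
      ContinuousLinearMap.flip_apply] at h3
    exact h3
  have h4 : HasFDerivAt (fun z => fderivWithin ℝ f S (t, z) (1, 0))
      (((fderivWithin ℝ (fderivWithin ℝ f S) S (t, y)).flip (1, 0)).comp
        (ContinuousLinearMap.inr ℝ ℝ E)) y := by
    have h2 : HasFDerivWithinAt (fun z : E => (t, z)) (ContinuousLinearMap.inr ℝ ℝ E) O y :=
      (hasFDerivAt_prodMk_right t y).hasFDerivWithinAt
    exact (HasFDerivWithinAt.comp y (key (1, 0)) h2
      (fun z hz => ⟨ht, hz⟩)).hasFDerivAt (hO.mem_nhds hy)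
  have h5 : (fun z => derivWithin (fun s => W s z) J t) =ᶠ[𝓝 y]
      fun z => fderivWithin ℝ f S (t, z) (1, 0) := by
    filter_upwards [hO.mem_nhds hy] with z hz
    exact (hasDerivWithinAt_prod_time (by simp) hW ht hz).derivWithin (hJ t ht)
  have h6 : fderiv ℝ (fun z => derivWithin (fun s => W s z) J t) y e =
      fderivWithin ℝ (fderivWithin ℝ f S) S (t, y) (1, 0) (0, e) := by
    rw [h5.fderiv_eq, h4.fderiv, hsymm (1, 0) (0, e)]
    simp
  rw [h6]
  exact h1.congr (fun s hs => fderivWithin_prod_space hO (by simp) hW hs hy e)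
    (fderivWithin_prod_space hO (by simp) hW ht hy e)

end Euclidean

/-! ### Partial derivatives in the charts of the surface -/

section Charts

variable {M : Type*} [TopologicalSpace M] [ChartedSpace (EuclideanSpace ℝ (Fin 2)) M]

/-- A real function on the surface is smooth in a neighbourhood of `x`. For `C^∞` this is stronger
than `ContMDiffAt` at the point. -/
def SmoothNear (f : M → ℝ) (x : M) : Prop := ∀ᶠ y in 𝓝 x, ContMDiffAt (𝓡 2) 𝓘(ℝ, ℝ) ∞ f y

/-- The real function `(t, x) ↦ w t x` is smooth on `J × V`, up to the endpoints of `J` that belong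
to `J`. -/
def JointSmooth (J : Set ℝ) (V : Set M) (w : ℝ → M → ℝ) : Prop :=
  ContMDiffOn (𝓘(ℝ, ℝ).prod (𝓡 2)) 𝓘(ℝ, ℝ) ∞ (fun p : ℝ × M => w p.1 p.2) (J ×ˢ V)

lemma pd_congr {c x : M} (hx : x ∈ (chartAt 𝔼 c).source) {f h : M → ℝ} (H : f =ᶠ[𝓝 x] h)
    (i : Fin 2) : pd c i f x = pd c i h x := by
  unfold pd
  have : Tendsto (extChartAt (𝓡 2) c).symm (𝓝 (extChartAt (𝓡 2) c x)) (𝓝 x) := by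
    have h1 := continuousAt_extChartAt_symm' (I := 𝓡 2) (x := c) (x' := x) (by simpa using hx)
    have h2 := (extChartAt (𝓡 2) c).left_inv (x := x) (by simpa using hx)
    unfold ContinuousAt at h1
    rwa [h2] at h1
  have H' : (fun y => f ((extChartAt (𝓡 2) c).symm y)) =ᶠ[𝓝 (extChartAt (𝓡 2) c x)]
      fun y => h ((extChartAt (𝓡 2) c).symm y) := this.eventually H
  rw [H'.fderiv_eq]

lemma pd_const (c x : M) (i : Fin 2) (a : ℝ) : pd c i (fun _ => a) x = 0 := by
  simp [pd]

variable [IsManifold (𝓡 2) ∞ M]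

lemma contDiffOn_chart {J : Set ℝ} {V : Set M} {w : ℝ → M → ℝ} (hw : JointSmooth J V w)
    (c : M) : ContDiffOn ℝ ∞ (fun p : ℝ × 𝔼 => w p.1 ((extChartAt (𝓡 2) c).symm p.2))
      (J ×ˢ ((extChartAt (𝓡 2) c).target ∩ (extChartAt (𝓡 2) c).symm ⁻¹' V)) := by
  rw [← contMDiffOn_iff_contDiffOn]
  have h1 : ContMDiffOn (𝓘(ℝ, ℝ × 𝔼)) (𝓘(ℝ, ℝ).prod (𝓡 2)) ∞
      (fun p : ℝ × 𝔼 => (p.1, (extChartAt (𝓡 2) c).symm p.2))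
      (J ×ˢ ((extChartAt (𝓡 2) c).target ∩ (extChartAt (𝓡 2) c).symm ⁻¹' V)) := by
    refine ContMDiffOn.prodMk ?_ ?_
    · exact contDiff_fst.contMDiff.contMDiffOn
    · exact (contMDiffOn_extChartAt_symm (I := 𝓡 2) (n := ∞) c).comp
        (contDiff_snd.contMDiff.contMDiffOn) (fun p hp => hp.2.1)
  exact ContMDiffOn.comp hw h1 (fun p hp => ⟨hp.1, hp.2.2⟩)

lemma isOpen_chart_preimage {V : Set M} (hV : IsOpen V) (c : M) :
    IsOpen ((extChartAt (𝓡 2) c).target ∩ (extChartAt (𝓡 2) c).symm ⁻¹' V) :=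
  (continuousOn_extChartAt_symm c).isOpen_inter_preimage (isOpen_extChartAt_target c) hV

lemma jointSmooth_of_chart {J : Set ℝ} {V : Set M} {c : M} (hVc : V ⊆ (chartAt 𝔼 c).source)
    {w : ℝ → M → ℝ} {W : ℝ → 𝔼 → ℝ} (hW : ContDiffOn ℝ ∞ (fun p : ℝ × 𝔼 => W p.1 p.2)
      (J ×ˢ ((extChartAt (𝓡 2) c).target ∩ (extChartAt (𝓡 2) c).symm ⁻¹' V)))
    (h : ∀ t ∈ J, ∀ x ∈ V, w t x = W t (extChartAt (𝓡 2) c x)) : JointSmooth J V w := by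
  rw [← contMDiffOn_iff_contDiffOn] at hW
  have h1 : ContMDiffOn (𝓘(ℝ, ℝ).prod (𝓡 2)) (𝓘(ℝ, ℝ × 𝔼)) ∞
      (fun p : ℝ × M => (p.1, extChartAt (𝓡 2) c p.2)) (J ×ˢ V) := by
    rw [modelWithCornersSelf_prod, ← chartedSpaceSelf_prod]
    refine ContMDiffOn.prodMk contMDiff_fst.contMDiffOn ?_
    exact (contMDiffOn_extChartAt (I := 𝓡 2) (n := ∞) (x := c)).comp
        (contMDiff_snd.contMDiffOn) (fun p hp => hVc hp.2)
  refine (hW.comp h1 ?_).congr fun p hp => h p.1 hp.1 p.2 hp.2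
  rintro p ⟨hp1, hp2⟩
  have hs : p.2 ∈ (extChartAt (𝓡 2) c).source := by simpa using hVc hp2
  refine ⟨hp1, (extChartAt (𝓡 2) c).map_source hs, ?_⟩
  rwa [mem_preimage, (extChartAt (𝓡 2) c).left_inv hs]

section Joint

variable {J : Set ℝ} {V : Set M} {w : ℝ → M → ℝ} {c : M}

lemma JointSmooth.pd (hw : JointSmooth J V w) (hJ : UniqueDiffOn ℝ J) (hV : IsOpen V)
    (hVc : V ⊆ (chartAt 𝔼 c).source) (i : Fin 2) :
    JointSmooth J V (fun t => RYM.pd c i (w t)) :=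
  jointSmooth_of_chart hVc
    (W := fun t y => fderiv ℝ (fun y => w t ((extChartAt (𝓡 2) c).symm y)) y
      (EuclideanSpace.single i 1))
    (contDiffOn_fderiv_space (W := fun t y => w t ((extChartAt (𝓡 2) c).symm y)) hJ
      (isOpen_chart_preimage hV c) (contDiffOn_chart hw c)
      (EuclideanSpace.single i 1)) fun _ _ _ _ => rfl

lemma JointSmooth.derivWithin_of_subset (hw : JointSmooth J V w) (hJ : UniqueDiffOn ℝ J)
    (hV : IsOpen V) (hVc : V ⊆ (chartAt 𝔼 c).source) :
    JointSmooth J V (fun t x => derivWithin (fun s => w s x) J t) :=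
  jointSmooth_of_chart hVc
    (W := fun t y => _root_.derivWithin (fun s => w s ((extChartAt (𝓡 2) c).symm y)) J t)
    (contDiffOn_derivWithin_time (W := fun t y => w t ((extChartAt (𝓡 2) c).symm y)) hJ
      (isOpen_chart_preimage hV c) (contDiffOn_chart hw c))
    fun t _ x hx => by
      rw [(extChartAt (𝓡 2) c).left_inv (by simpa using hVc hx)]

lemma JointSmooth.hasDerivWithinAt (hw : JointSmooth J V w)
    {t : ℝ} (ht : t ∈ J) {x : M} (hx : x ∈ V) :
    HasDerivWithinAt (fun s => w s x) (derivWithin (fun s => w s x) J t) J t := by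
  have h1 := hasDerivWithinAt_prod_time (n := ∞)
    (W := fun t y => w t ((extChartAt (𝓡 2) x).symm y)) (by simp) (contDiffOn_chart hw x) ht
    (y := extChartAt (𝓡 2) x x) ⟨mem_extChartAt_target x, by
      rwa [mem_preimage, extChartAt_to_inv]⟩
  simp only [extChartAt_to_inv] at h1
  exact h1.differentiableWithinAt.hasDerivWithinAt

lemma JointSmooth.hasDerivWithinAt_pd (hw : JointSmooth J V w) (hJ : UniqueDiffOn ℝ J)
    (hJ' : J ⊆ closure (interior J)) (hV : IsOpen V) {x : M} (hxc : x ∈ (chartAt 𝔼 c).source)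
    (i : Fin 2) {t : ℝ} (ht : t ∈ J) (hx : x ∈ V) :
    HasDerivWithinAt (fun s => RYM.pd c i (w s) x)
      (RYM.pd c i (fun y => derivWithin (fun s => w s y) J t) x) J t := by
  have hs : x ∈ (extChartAt (𝓡 2) c).source := by simpa using hxc
  exact hasDerivWithinAt_fderiv_space
      (W := fun t y => w t ((extChartAt (𝓡 2) c).symm y)) hJ hJ' (isOpen_chart_preimage hV c)
      (contDiffOn_chart hw c) (EuclideanSpace.single i 1) ht
      ⟨(extChartAt (𝓡 2) c).map_source hs, by
        rwa [mem_preimage, (extChartAt (𝓡 2) c).left_inv hs]⟩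

lemma JointSmooth.mono {V' : Set M} (hw : JointSmooth J V w) (h : V' ⊆ V) :
    JointSmooth J V' w :=
  ContMDiffOn.mono hw (prod_mono Subset.rfl h)

lemma jointSmooth_of_locally
    (h : ∀ x ∈ V, ∃ V', IsOpen V' ∧ x ∈ V' ∧ JointSmooth J (V ∩ V') w) : JointSmooth J V w := by
  rintro ⟨t, x⟩ ⟨ht, hx⟩
  obtain ⟨V', hV', hxV', hw⟩ := h x hx
  refine (hw (t, x) ⟨ht, hx, hxV'⟩).mono_of_mem_nhdsWithin ?_
  rw [mem_nhdsWithin]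
  exact ⟨univ ×ˢ V', isOpen_univ.prod hV', ⟨mem_univ _, hxV'⟩, fun p hp => ⟨hp.2.1, hp.2.2, hp.1.2⟩⟩

lemma JointSmooth.derivWithin (hw : JointSmooth J V w) (hJ : UniqueDiffOn ℝ J)
    (hV : IsOpen V) : JointSmooth J V (fun t x => derivWithin (fun s => w s x) J t) :=
  jointSmooth_of_locally fun x _ => ⟨(chartAt 𝔼 x).source, (chartAt 𝔼 x).open_source,
    mem_chart_source _ x, (hw.mono inter_subset_left).derivWithin_of_subset (c := x) hJ
      (hV.inter (chartAt 𝔼 x).open_source) inter_subset_right⟩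

lemma JointSmooth.continuousOn (hw : JointSmooth J V w) :
    ContinuousOn (fun p : ℝ × M => w p.1 p.2) (J ×ˢ V) := ContMDiffOn.continuousOn hw

lemma JointSmooth.contMDiffOn (hw : JointSmooth J V w) {t : ℝ} (ht : t ∈ J) :
    ContMDiffOn (𝓡 2) 𝓘(ℝ, ℝ) ∞ (w t) V :=
  ContMDiffOn.comp (t := J ×ˢ V) hw
    ((contMDiff_const (c := t)).prodMk contMDiff_id).contMDiffOn fun _ hx => ⟨ht, hx⟩

lemma smoothNear_of_contMDiffOn {f : M → ℝ} (hV : IsOpen V)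
    (hf : ContMDiffOn (𝓡 2) 𝓘(ℝ, ℝ) ∞ f V) {x : M} (hx : x ∈ V) : SmoothNear f x := by
  filter_upwards [hV.mem_nhds hx] with y hy
  exact hf.contMDiffAt (hV.mem_nhds hy)

lemma JointSmooth.smoothNear (hw : JointSmooth J V w) {t : ℝ} (ht : t ∈ J) (hV : IsOpen V)
    {x : M} (hx : x ∈ V) : SmoothNear (w t) x :=
  smoothNear_of_contMDiffOn hV (hw.contMDiffOn ht) hx

lemma jointSmooth_of_static {f : M → ℝ} (hf : ContMDiffOn (𝓡 2) 𝓘(ℝ, ℝ) ∞ f V) :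
    JointSmooth J V (fun _ => f) :=
  hf.comp contMDiff_snd.contMDiffOn fun _ hp => hp.2

end Joint

lemma contMDiffOn_pd {V : Set M} (hV : IsOpen V) {c : M} (hVc : V ⊆ (chartAt 𝔼 c).source)
    {f : M → ℝ} (hf : ContMDiffOn (𝓡 2) 𝓘(ℝ, ℝ) ∞ f V) (i : Fin 2) :
    ContMDiffOn (𝓡 2) 𝓘(ℝ, ℝ) ∞ (pd c i f) V :=
  ((jointSmooth_of_static (J := univ) hf).pd uniqueDiffOn_univ hV hVc i).contMDiffOn
    (mem_univ 0)

lemma SmoothNear.pd {c x : M} {f : M → ℝ} (hf : SmoothNear f x)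
    (hx : x ∈ (chartAt 𝔼 c).source) (i : Fin 2) : SmoothNear (pd c i f) x := by
  obtain ⟨V, hV, hVo, hxV⟩ := eventually_nhds_iff.1 hf
  have ho := hVo.inter (chartAt 𝔼 c).open_source
  have h := contMDiffOn_pd ho inter_subset_right
    (f := f) (fun y hy => (hV y hy.1).contMDiffWithinAt) i
  filter_upwards [ho.mem_nhds ⟨hxV, hx⟩] with y hy
  exact h.contMDiffAt (ho.mem_nhds hy)

end Charts

section Frames

variable {M : Type*} [TopologicalSpace M] [ChartedSpace (EuclideanSpace ℝ (Fin 2)) M]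

/-! ### Calculus rules for functions that are smooth near a point -/

section SmoothNear

variable {f h : M → ℝ} {c x : M}

lemma SmoothNear.contMDiffAt (hf : SmoothNear f x) : ContMDiffAt (𝓡 2) 𝓘(ℝ, ℝ) ∞ f x :=
  hf.self_of_nhds

lemma SmoothNear.mdifferentiableAt (hf : SmoothNear f x) :
    MDifferentiableAt (𝓡 2) 𝓘(ℝ, ℝ) f x :=
  hf.contMDiffAt.mdifferentiableAt (by simp)

lemma SmoothNear.eventually (hf : SmoothNear f x) : ∀ᶠ y in 𝓝 x, SmoothNear f y :=
  eventually_eventually_nhds.2 hf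

lemma smoothNear_const (a : ℝ) : SmoothNear (fun _ : M => a) x :=
  Eventually.of_forall fun _ => contMDiffAt_const

lemma SmoothNear.add (hf : SmoothNear f x) (hh : SmoothNear h x) :
    SmoothNear (fun y => f y + h y) x := by
  filter_upwards [hf, hh] with y h1 h2 using h1.add h2

lemma SmoothNear.neg (hf : SmoothNear f x) : SmoothNear (fun y => -f y) x := by
  filter_upwards [hf] with y h1 using h1.neg

lemma SmoothNear.sub (hf : SmoothNear f x) (hh : SmoothNear h x) :
    SmoothNear (fun y => f y - h y) x := by
  filter_upwards [hf, hh] with y h1 h2 using h1.sub h2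

lemma SmoothNear.mul (hf : SmoothNear f x) (hh : SmoothNear h x) :
    SmoothNear (fun y => f y * h y) x := by
  filter_upwards [hf, hh] with y h1 h2 using h1.mul h2

lemma SmoothNear.pow (hf : SmoothNear f x) (n : ℕ) : SmoothNear (fun y => f y ^ n) x := by
  filter_upwards [hf] with y h1 using h1.pow n

lemma SmoothNear.sum {α : Type*} {s : Finset α} {F : α → M → ℝ}
    (hf : ∀ i ∈ s, SmoothNear (F i) x) : SmoothNear (fun y => ∑ i ∈ s, F i y) x := by
  have : ∀ᶠ y in 𝓝 x, ∀ i ∈ s, ContMDiffAt (𝓡 2) 𝓘(ℝ, ℝ) ∞ (F i) y :=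
    (s.eventually_all).2 hf
  filter_upwards [this] with y hy
  exact contMDiffAt_finsetSum hy

lemma SmoothNear.congr (hf : SmoothNear f x) (H : h =ᶠ[𝓝 x] f) : SmoothNear h x := by
  filter_upwards [hf, eventually_eventually_nhds.2 H] with y h1 h2
    using h1.congr_of_eventuallyEq h2

lemma SmoothNear.comp {φ : ℝ → ℝ} {O : Set ℝ} (hO : IsOpen O) (hφ : ContDiffOn ℝ ∞ φ O)
    (hf : SmoothNear f x) (hx : f x ∈ O) : SmoothNear (fun y => φ (f y)) x := by
  filter_upwards [hf, hf.contMDiffAt.continuousAt (hO.mem_nhds hx)] with y h1 h2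
  exact (hφ.contDiffAt (hO.mem_nhds h2)).comp_contMDiffAt h1

lemma SmoothNear.exp (hf : SmoothNear f x) : SmoothNear (fun y => Real.exp (f y)) x :=
  hf.comp isOpen_univ Real.contDiff_exp.contDiffOn (mem_univ _)

lemma SmoothNear.inv (hf : SmoothNear f x) (hx : f x ≠ 0) : SmoothNear (fun y => (f y)⁻¹) x :=
  hf.comp isOpen_compl_singleton (O := {0}ᶜ)
    (contDiffOn_id.inv fun _ h => h) hx

lemma SmoothNear.div (hf : SmoothNear f x) (hh : SmoothNear h x) (hx : h x ≠ 0) :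
    SmoothNear (fun y => f y / h y) x := by
  simpa only [div_eq_mul_inv] using hf.mul (hh.inv hx)

lemma SmoothNear.sqrt (hf : SmoothNear f x) (hx : 0 < f x) :
    SmoothNear (fun y => Real.sqrt (f y)) x :=
  hf.comp isOpen_Ioi (contDiffOn_id.sqrt fun _ h => (ne_of_gt h)) hx

lemma SmoothNear.continuousAt (hf : SmoothNear f x) : ContinuousAt f x :=
  hf.contMDiffAt.continuousAt

lemma contMDiffOn_of_smoothNear {V : Set M} (hf : ∀ x ∈ V, SmoothNear f x) :
    ContMDiffOn (𝓡 2) 𝓘(ℝ, ℝ) ∞ f V :=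
  fun x hx => (hf x hx).contMDiffAt.contMDiffWithinAt

lemma smoothNear_of_contMDiff (hf : ContMDiff (𝓡 2) 𝓘(ℝ, ℝ) ∞ f) (x : M) : SmoothNear f x :=
  Eventually.of_forall fun y => hf y

variable [IsManifold (𝓡 2) ∞ M]

lemma SmoothNear.differentiableAt_chart (hf : SmoothNear f x) (hx : x ∈ (chartAt 𝔼 c).source) :
    DifferentiableAt ℝ (fun y => f ((extChartAt (𝓡 2) c).symm y)) (extChartAt (𝓡 2) c x) := by
  have hs : x ∈ (extChartAt (𝓡 2) c).source := by simpa using hx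
  have ht := (extChartAt (𝓡 2) c).map_source hs
  have h1 : ContMDiffAt 𝓘(ℝ, 𝔼) (𝓡 2) ∞ (extChartAt (𝓡 2) c).symm (extChartAt (𝓡 2) c x) :=
    (contMDiffOn_extChartAt_symm (I := 𝓡 2) (n := ∞) c).contMDiffAt
      ((isOpen_extChartAt_target c).mem_nhds ht)
  have h2 : ContMDiffAt 𝓘(ℝ, 𝔼) 𝓘(ℝ, ℝ) ∞ (f ∘ (extChartAt (𝓡 2) c).symm)
      (extChartAt (𝓡 2) c x) := by
    refine ContMDiffAt.comp _ ?_ h1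
    rw [(extChartAt (𝓡 2) c).left_inv hs]
    exact hf.contMDiffAt
  exact h2.contDiffAt.differentiableAt (by simp)

lemma pd_add (hf : SmoothNear f x) (hh : SmoothNear h x) (hx : x ∈ (chartAt 𝔼 c).source)
    (i : Fin 2) : pd c i (fun y => f y + h y) x = pd c i f x + pd c i h x := by
  simp only [pd]
  rw [fderiv_fun_add (hf.differentiableAt_chart hx) (hh.differentiableAt_chart hx)]; rfl

lemma pd_sub (hf : SmoothNear f x) (hh : SmoothNear h x) (hx : x ∈ (chartAt 𝔼 c).source)
    (i : Fin 2) : pd c i (fun y => f y - h y) x = pd c i f x - pd c i h x := by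
  simp only [pd]
  rw [fderiv_fun_sub (hf.differentiableAt_chart hx) (hh.differentiableAt_chart hx)]; rfl

lemma pd_neg (c x : M) (f : M → ℝ) (i : Fin 2) : pd c i (fun y => -f y) x = -pd c i f x := by
  simp only [pd]
  rw [fderiv_fun_neg]; rfl

lemma pd_mul (hf : SmoothNear f x) (hh : SmoothNear h x) (hx : x ∈ (chartAt 𝔼 c).source)
    (i : Fin 2) :
    pd c i (fun y => f y * h y) x = f x * pd c i h x + h x * pd c i f x := by
  have hs : x ∈ (extChartAt (𝓡 2) c).source := by simpa using hx
  simp only [pd]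
  rw [fderiv_fun_mul (hf.differentiableAt_chart hx) (hh.differentiableAt_chart hx)]
  simp only [(extChartAt (𝓡 2) c).left_inv hs]
  rfl

lemma pd_sum {α : Type*} {s : Finset α} {F : α → M → ℝ}
    (hf : ∀ i ∈ s, SmoothNear (F i) x) (hx : x ∈ (chartAt 𝔼 c).source) (i : Fin 2) :
    pd c i (fun y => ∑ a ∈ s, F a y) x = ∑ a ∈ s, pd c i (F a) x := by
  simp only [pd]
  rw [fderiv_fun_sum fun a ha => (hf a ha).differentiableAt_chart hx]
  simp

/-- Second partial derivatives commute. -/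
lemma pd_comm (hf : SmoothNear f x) (hx : x ∈ (chartAt 𝔼 c).source) (i j : Fin 2) :
    pd c i (pd c j f) x = pd c j (pd c i f) x := by
  have hs : x ∈ (extChartAt (𝓡 2) c).source := by simpa using hx
  obtain ⟨V, hV, hVo, hxV⟩ := eventually_nhds_iff.1 hf
  have h0 : ContMDiffOn (𝓡 2) 𝓘(ℝ, ℝ) ∞ f V := fun y hy => (hV y hy).contMDiffWithinAt
  set F := fun y => f ((extChartAt (𝓡 2) c).symm y) with hF
  have hO := isOpen_chart_preimage hVo c
  set O := (extChartAt (𝓡 2) c).target ∩ (extChartAt (𝓡 2) c).symm ⁻¹' V with hOdef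
  have hFO : ContDiffOn ℝ ∞ F O := by
    have h1 := contDiffOn_chart (jointSmooth_of_static (J := univ) h0) c
    exact h1.comp (contDiffOn_const (c := (0 : ℝ)) |>.prodMk contDiffOn_id)
      (fun y hy => ⟨mem_univ _, hy⟩)
  have hxO : extChartAt (𝓡 2) c x ∈ O :=
    ⟨(extChartAt (𝓡 2) c).map_source hs, by rwa [mem_preimage, (extChartAt (𝓡 2) c).left_inv hs]⟩
  have hsymm : IsSymmSndFDerivAt ℝ F (extChartAt (𝓡 2) c x) := by
    refine (hFO.contDiffAt (hO.mem_nhds hxO)).isSymmSndFDerivAt ?_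
    rw [minSmoothness_of_isRCLikeNormedField]; exact two_le_infty
  have key : ∀ a b : Fin 2, pd c a (pd c b f) x =
      fderiv ℝ (fderiv ℝ F) (extChartAt (𝓡 2) c x) (EuclideanSpace.single a 1)
        (EuclideanSpace.single b 1) := by
    intro a b
    have h1 : (fun y => pd c b f ((extChartAt (𝓡 2) c).symm y)) =ᶠ[𝓝 (extChartAt (𝓡 2) c x)]
        fun y => fderiv ℝ F y (EuclideanSpace.single b 1) := by
      filter_upwards [hO.mem_nhds hxO] with y hy
      simp only [pd]
      rw [(extChartAt (𝓡 2) c).right_inv hy.1]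
    conv_lhs => rw [pd]
    rw [h1.fderiv_eq]
    have h2 : DifferentiableAt ℝ (fderiv ℝ F) (extChartAt (𝓡 2) c x) :=
      ((hFO.fderiv_of_isOpen hO (m := ∞) (by simp)).contDiffAt
        (hO.mem_nhds hxO)).differentiableAt (by simp)
    rw [fderiv_clm_apply h2 (differentiableAt_const _)]
    simp
  rw [key, key, hsymm]

end SmoothNear

/-! ### The coordinate frames of two charts -/

variable [IsManifold (𝓡 2) ∞ M] {c c' x : M}

lemma mem_baseSet_tangent (hx : x ∈ (chartAt 𝔼 c).source) :
    x ∈ (trivializationAt 𝔼 (TangentSpace (𝓡 2)) c).baseSet := by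
  simpa using hx

lemma symm_mem_chart_source {y : 𝔼} (hy : y ∈ (extChartAt (𝓡 2) c).target) :
    (extChartAt (𝓡 2) c).symm y ∈ (chartAt 𝔼 c).source := by
  have := (extChartAt (𝓡 2) c).map_target hy
  rwa [extChartAt_source] at this

lemma coord_coordFrame (hx : x ∈ (chartAt 𝔼 c).source) (i j : Fin 2) :
    coord c i x (coordFrame c j x) = if i = j then 1 else 0 := by
  unfold coord coordFrame
  rw [Trivialization.continuousLinearMapAt_symmL _ (mem_baseSet_tangent hx)]
  simp

lemma sum_coord_smul_coordFrame (hx : x ∈ (chartAt 𝔼 c).source) (v : TangentSpace (𝓡 2) x) :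
    v = coord c 0 x v • coordFrame c 0 x + coord c 1 x v • coordFrame c 1 x := by
  have h := Trivialization.symmL_continuousLinearMapAt (R := ℝ)
    (trivializationAt 𝔼 (TangentSpace (𝓡 2)) c) (mem_baseSet_tangent hx) v
  conv_lhs => rw [← h]
  unfold coord coordFrame
  rw [← map_smul, ← map_smul, ← map_add]
  congr 1
  ext i
  fin_cases i <;> simp

lemma coord_add (c : M) (i : Fin 2) (x : M) (v w : TangentSpace (𝓡 2) x) :
    coord c i x (v + w) = coord c i x v + coord c i x w := by
  simp [coord]

lemma coord_smul (c : M) (i : Fin 2) (x : M) (a : ℝ) (v : TangentSpace (𝓡 2) x) :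
    coord c i x (a • v) = a * coord c i x v := by
  simp [coord]

/-- Partial derivatives are values of the differential on the coordinate frame. This makes first
order expressions chart-independent by linear algebra. -/
lemma pd_eq_mfderiv (hx : x ∈ (chartAt 𝔼 c).source) {f : M → ℝ}
    (hf : MDifferentiableAt (𝓡 2) 𝓘(ℝ, ℝ) f x) (i : Fin 2) :
    pd c i f x = mfderiv (𝓡 2) 𝓘(ℝ, ℝ) f x (coordFrame c i x) := by
  have hs : x ∈ (extChartAt (𝓡 2) c).source := by simpa using hx
  unfold coordFrame pd
  rw [TangentBundle.symmL_trivializationAt hx]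
  have h1 : MDifferentiableAt 𝓘(ℝ, 𝔼) (𝓡 2) (extChartAt (𝓡 2) c).symm
      (extChartAt (𝓡 2) c x) :=
    ((contMDiffOn_extChartAt_symm (I := 𝓡 2) (n := ∞) c).contMDiffAt
      ((isOpen_extChartAt_target c).mem_nhds
        ((extChartAt (𝓡 2) c).map_source hs))).mdifferentiableAt (by simp)
  have hf' : MDifferentiableAt (𝓡 2) 𝓘(ℝ, ℝ) f
      ((extChartAt (𝓡 2) c).symm (extChartAt (𝓡 2) c x)) := by
    rwa [(extChartAt (𝓡 2) c).left_inv hs]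
  have h2 := mfderiv_comp _ hf' h1
  rw [mfderiv_eq_fderiv] at h2
  have h3 : (fun y => f ((extChartAt (𝓡 2) c).symm y)) = f ∘ (extChartAt (𝓡 2) c).symm := rfl
  rw [h3, h2]
  simp only [modelWithCornersSelf_coe, range_id, mfderivWithin_univ]
  have h4 := (extChartAt (𝓡 2) c).left_inv hs
  exact congrArg (fun z => (mfderiv (𝓡 2) 𝓘(ℝ, ℝ) f z : 𝔼 →L[ℝ] ℝ)
    (mfderiv 𝓘(ℝ, 𝔼) (𝓡 2) (extChartAt (𝓡 2) c).symm (extChartAt (𝓡 2) c x)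
      (EuclideanSpace.single i 1))) h4

/-- The matrix of the differential of the coordinate change: `∂ⱼ^c = ∑ₖ T_{kj} ∂ₖ^{c'}`. -/
def frameChange (c' c x : M) (k j : Fin 2) : ℝ := coord c' k x (coordFrame c j x)

lemma coordFrame_change (hx' : x ∈ (chartAt 𝔼 c').source) (j : Fin 2) :
    coordFrame c j x = frameChange c' c x 0 j • coordFrame c' 0 x +
      frameChange c' c x 1 j • coordFrame c' 1 x :=
  sum_coord_smul_coordFrame hx' _

lemma pd_change (hx : x ∈ (chartAt 𝔼 c).source) (hx' : x ∈ (chartAt 𝔼 c').source)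
    {f : M → ℝ} (hf : MDifferentiableAt (𝓡 2) 𝓘(ℝ, ℝ) f x) (j : Fin 2) :
    pd c j f x = frameChange c' c x 0 j * pd c' 0 f x + frameChange c' c x 1 j * pd c' 1 f x := by
  rw [pd_eq_mfderiv hx hf, pd_eq_mfderiv hx' hf, pd_eq_mfderiv hx' hf,
    coordFrame_change (c := c) (c' := c') hx' j, map_add, map_smul, map_smul]
  rfl

/-- The `k`-th coordinate function of the chart around `c`. -/
def coordFun (c : M) (k : Fin 2) (x : M) : ℝ := extChartAt (𝓡 2) c x k

lemma smoothNear_coordFun (hx : x ∈ (chartAt 𝔼 c).source) (k : Fin 2) :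
    SmoothNear (coordFun c k) x := by
  refine smoothNear_of_contMDiffOn (chartAt 𝔼 c).open_source ?_ hx
  have h1 : ContDiff ℝ ∞ (fun v : 𝔼 => v k) := by fun_prop
  exact (contMDiff_iff_contDiff.2 h1).comp_contMDiffOn
    (contMDiffOn_extChartAt (I := 𝓡 2) (n := ∞) (x := c))

lemma frameChange_eq_pd (hx : x ∈ (chartAt 𝔼 c).source) (hx' : x ∈ (chartAt 𝔼 c').source)
    (k j : Fin 2) : frameChange c' c x k j = pd c j (coordFun c' k) x := by
  rw [pd_eq_mfderiv hx (smoothNear_coordFun hx' k).mdifferentiableAt]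
  unfold frameChange coord
  rw [TangentBundle.continuousLinearMapAt_trivializationAt hx']
  have h1 : MDifferentiableAt (𝓡 2) 𝓘(ℝ, 𝔼) (extChartAt (𝓡 2) c') x :=
    mdifferentiableAt_extChartAt hx'
  have h2 : DifferentiableAt ℝ (fun v : 𝔼 => v k) (extChartAt (𝓡 2) c' x) := by fun_prop
  have h3 := mfderiv_comp x h2.mdifferentiableAt h1
  have h4 : coordFun c' k = (fun v : 𝔼 => v k) ∘ extChartAt (𝓡 2) c' := rfl
  rw [h4, h3, mfderiv_eq_fderiv]
  have h5 : fderiv ℝ (fun v : 𝔼 => v k) (extChartAt (𝓡 2) c' x) = EuclideanSpace.proj k :=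
    (EuclideanSpace.proj (𝕜 := ℝ) k).fderiv
  rw [h5]; rfl

lemma smoothNear_frameChange (hx : x ∈ (chartAt 𝔼 c).source) (hx' : x ∈ (chartAt 𝔼 c').source)
    (k j : Fin 2) : SmoothNear (fun y => frameChange c' c y k j) x := by
  refine ((smoothNear_coordFun hx' k).pd hx j).congr ?_
  filter_upwards [(chartAt 𝔼 c).open_source.mem_nhds hx,
    (chartAt 𝔼 c').open_source.mem_nhds hx'] with y h1 h2 using frameChange_eq_pd h1 h2 k j

/-- The Jacobian determinant of the coordinate change. -/
def jac (c' c x : M) : ℝ :=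
  frameChange c' c x 0 0 * frameChange c' c x 1 1 - frameChange c' c x 0 1 * frameChange c' c x 1 0

lemma frameChange_mul (hx : x ∈ (chartAt 𝔼 c).source) (hx' : x ∈ (chartAt 𝔼 c').source)
    (k l : Fin 2) : frameChange c' c x k 0 * frameChange c c' x 0 l +
      frameChange c' c x k 1 * frameChange c c' x 1 l = if k = l then 1 else 0 := by
  rw [← coord_coordFrame hx' k l, coordFrame_change (c' := c) (c := c') hx l, coord_add,
    coord_smul, coord_smul]
  unfold frameChange; ring

lemma jac_mul_jac (hx : x ∈ (chartAt 𝔼 c).source) (hx' : x ∈ (chartAt 𝔼 c').source) :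
    jac c' c x * jac c c' x = 1 := by
  have h00 := frameChange_mul hx hx' 0 0
  have h01 := frameChange_mul hx hx' 0 1
  have h10 := frameChange_mul hx hx' 1 0
  have h11 := frameChange_mul hx hx' 1 1
  simp at h00 h01 h10 h11
  unfold jac
  linear_combination (frameChange c' c x 1 0 * frameChange c c' x 0 1 +
      frameChange c' c x 1 1 * frameChange c c' x 1 1) * h00 + h11 -
      (frameChange c' c x 1 0 * frameChange c c' x 0 0 +
        frameChange c' c x 1 1 * frameChange c c' x 1 0) * h01

lemma jac_ne_zero (hx : x ∈ (chartAt 𝔼 c).source) (hx' : x ∈ (chartAt 𝔼 c').source) :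
    jac c' c x ≠ 0 := left_ne_zero_of_mul_eq_one (jac_mul_jac hx hx')

lemma continuousAt_jac (hx : x ∈ (chartAt 𝔼 c).source) (hx' : x ∈ (chartAt 𝔼 c').source) :
    ContinuousAt (jac c' c) x :=
  (((smoothNear_frameChange hx hx' 0 0).mul (smoothNear_frameChange hx hx' 1 1)).sub
    ((smoothNear_frameChange hx hx' 0 1).mul (smoothNear_frameChange hx hx' 1 0))).continuousAt

/-- The sign of the Jacobian of a coordinate change is locally constant. -/
lemma eventually_sign_jac (hx : x ∈ (chartAt 𝔼 c).source) (hx' : x ∈ (chartAt 𝔼 c').source) :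
    ∀ᶠ y in 𝓝 x, SignType.sign (jac c' c y) = SignType.sign (jac c' c x) := by
  rcases lt_or_gt_of_ne (jac_ne_zero hx hx') with h | h
  · filter_upwards [(continuousAt_jac hx hx').eventually_lt continuousAt_const h] with y hy
    rw [sign_neg hy, sign_neg h]
  · filter_upwards [continuousAt_const.eventually_lt (continuousAt_jac hx hx') h] with y hy
    rw [sign_pos hy, sign_pos h]

end Frames

section Metric

variable {M : Type*} [TopologicalSpace M] [ChartedSpace (EuclideanSpace ℝ (Fin 2)) M]
  [IsManifold (𝓡 2) ∞ M] {c c' x : M}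

/-! ### The exterior derivative of a one-form in an arbitrary chart -/

/-- The component `∂₀ α₁ - ∂₁ α₀` of `dα` in the chart around `c`. -/
def curl (c : M) (α : ∀ x : M, TangentSpace (𝓡 2) x → ℝ) (x : M) : ℝ :=
  pd c 0 (fun y => α y (coordFrame c 1 y)) x - pd c 1 (fun y => α y (coordFrame c 0 y)) x

lemma chart_source_mem_nhds (hx : x ∈ (chartAt 𝔼 c).source) :
    ∀ᶠ y in 𝓝 x, y ∈ (chartAt 𝔼 c).source :=
  (chartAt 𝔼 c).open_source.mem_nhds hx

lemma isLinearMap_coordFrame_change {α : TangentSpace (𝓡 2) x → ℝ} (hα : IsLinearMap ℝ α)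
    (hx' : x ∈ (chartAt 𝔼 c').source) (j : Fin 2) :
    α (coordFrame c j x) = frameChange c' c x 0 j * α (coordFrame c' 0 x) +
      frameChange c' c x 1 j * α (coordFrame c' 1 x) := by
  rw [coordFrame_change (c := c) hx' j, hα.map_add, hα.map_smul, hα.map_smul]; rfl

/-- The exterior derivative is natural: under a coordinate change the component of `dα` is
multiplied by the Jacobian, because the second derivatives of the coordinate change cancel. -/
lemma curl_change {α : ∀ x : M, TangentSpace (𝓡 2) x → ℝ}
    (hα : ∀ᶠ y in 𝓝 x, IsLinearMap ℝ (α y))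
    (hx : x ∈ (chartAt 𝔼 c).source) (hx' : x ∈ (chartAt 𝔼 c').source)
    (hs : ∀ l, SmoothNear (fun y => α y (coordFrame c' l y)) x) :
    curl c α x = jac c' c x * curl c' α x := by
  have hT : ∀ k j, (fun y => frameChange c' c y k j) =ᶠ[𝓝 x] pd c j (coordFun c' k) := by
    intro k j
    filter_upwards [chart_source_mem_nhds hx, chart_source_mem_nhds hx'] with y h1 h2
      using frameChange_eq_pd h1 h2 k j
  have hTs := smoothNear_frameChange hx hx'
  have key : ∀ i j, pd c i (fun y => α y (coordFrame c j y)) x =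
      ∑ k, (frameChange c' c x k j * pd c i (fun y => α y (coordFrame c' k y)) x +
        α x (coordFrame c' k x) * pd c i (pd c j (coordFun c' k)) x) := by
    intro i j
    have h1 : (fun y => α y (coordFrame c j y)) =ᶠ[𝓝 x]
        fun y => frameChange c' c y 0 j * α y (coordFrame c' 0 y) +
          frameChange c' c y 1 j * α y (coordFrame c' 1 y) := by
      filter_upwards [hα, chart_source_mem_nhds hx'] with y h1 h2
        using isLinearMap_coordFrame_change h1 h2 j
    rw [pd_congr hx h1, pd_add ((hTs 0 j).mul (hs 0)) ((hTs 1 j).mul (hs 1)) hx,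
      pd_mul (hTs 0 j) (hs 0) hx, pd_mul (hTs 1 j) (hs 1) hx, pd_congr hx (hT 0 j),
      pd_congr hx (hT 1 j), Fin.sum_univ_two]
  have hc := fun k => pd_comm (smoothNear_coordFun hx' k) hx 0 1
  unfold curl
  rw [key, key]
  simp only [Fin.sum_univ_two, hc]
  simp only [pd_change hx hx' (hs _).mdifferentiableAt, jac]
  ring

lemma extD_apply (α : ∀ x : M, TangentSpace (𝓡 2) x → ℝ) (x : M) (v w : TangentSpace (𝓡 2) x) :
    extD α x v w =
      curl x α x * (coord x 0 x v * coord x 1 x w - coord x 1 x v * coord x 0 x w) := by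
  simp only [extD, curl, Fin.sum_univ_two]; ring

/-- The component of `dα` in a fixed chart, although `extD` uses a different chart at each point. -/
lemma comp_extD {α : ∀ x : M, TangentSpace (𝓡 2) x → ℝ}
    (hα : ∀ᶠ y in 𝓝 x, IsLinearMap ℝ (α y)) (hx : x ∈ (chartAt 𝔼 c).source)
    (hs : ∀ l, SmoothNear (fun y => α y (coordFrame x l y)) x) :
    comp (extD α) c 0 1 x = curl c α x := by
  rw [curl_change hα hx (mem_chart_source 𝔼 x) hs, comp, extD_apply]
  simp only [jac, frameChange]; ring

lemma comp_extD_swap (α : ∀ x : M, TangentSpace (𝓡 2) x → ℝ) (c x : M) :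
    comp (extD α) c 1 0 x = -comp (extD α) c 0 1 x := by
  simp only [comp, extD_apply]; ring

lemma comp_extD_self (α : ∀ x : M, TangentSpace (𝓡 2) x → ℝ) (c x : M) (i : Fin 2) :
    comp (extD α) c i i x = 0 := by
  simp only [comp, extD_apply]; ring

lemma smoothNear_form_change {α : ∀ x : M, TangentSpace (𝓡 2) x → ℝ}
    (hα : ∀ᶠ y in 𝓝 x, IsLinearMap ℝ (α y))
    (hx : x ∈ (chartAt 𝔼 c).source) (hx' : x ∈ (chartAt 𝔼 c').source)
    (hs : ∀ l, SmoothNear (fun y => α y (coordFrame c' l y)) x) (l : Fin 2) :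
    SmoothNear (fun y => α y (coordFrame c l y)) x := by
  refine (((smoothNear_frameChange hx hx' 0 l).mul (hs 0)).add
    ((smoothNear_frameChange hx hx' 1 l).mul (hs 1))).congr ?_
  filter_upwards [hα, chart_source_mem_nhds hx'] with y h1 h2
    using isLinearMap_coordFrame_change h1 h2 l

/-! ### Riemannian metrics in charts -/

/-- A smooth Riemannian metric: a symmetric positive definite 2-tensor field whose components are
smooth in every chart. -/
structure IsSmoothMetric (g : TensorField₂ M) : Prop where
  add_left : ∀ x v v' w, g x (v + v') w = g x v w + g x v' w
  smul_left : ∀ x (a : ℝ) v w, g x (a • v) w = a * g x v w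
  symm : ∀ x v w, g x v w = g x w v
  pos : ∀ x v, v ≠ 0 → 0 < g x v v
  smooth : ∀ c i j, ContMDiffOn (𝓡 2) 𝓘(ℝ, ℝ) ∞ (comp g c i j) (chartAt 𝔼 c).source

variable {g : TensorField₂ M}

/-- The density `(det g)^{1/2}` of the volume in the chart around `c`. -/
def vol (g : TensorField₂ M) (c x : M) : ℝ := Real.sqrt (gram g c x).det

lemma det_gram (g : TensorField₂ M) (c x : M) : (gram g c x).det =
    comp g c 0 0 x * comp g c 1 1 x - comp g c 0 1 x * comp g c 1 0 x := by
  simp [gram, Matrix.det_fin_two]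

namespace IsSmoothMetric

variable (hg : IsSmoothMetric g)
include hg

lemma add_right (x : M) (v w w' : TangentSpace (𝓡 2) x) :
    g x v (w + w') = g x v w + g x v w' := by
  rw [hg.symm, hg.add_left, hg.symm x w, hg.symm x w']

lemma smul_right (x : M) (a : ℝ) (v w : TangentSpace (𝓡 2) x) : g x v (a • w) = a * g x v w := by
  rw [hg.symm, hg.smul_left, hg.symm]

lemma comp_symm (c x : M) : comp g c 1 0 x = comp g c 0 1 x := hg.symm _ _ _

lemma smoothNear_comp (hx : x ∈ (chartAt 𝔼 c).source) (i j : Fin 2) :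
    SmoothNear (comp g c i j) x :=
  smoothNear_of_contMDiffOn (chartAt 𝔼 c).open_source (hg.smooth c i j) hx

lemma det_pos (hx : x ∈ (chartAt 𝔼 c).source) : 0 < (gram g c x).det := by
  rw [det_gram, hg.comp_symm]
  have key : ∀ a b : ℝ, (a ≠ 0 ∨ b ≠ 0) → 0 < a * a * comp g c 0 0 x +
      2 * a * b * comp g c 0 1 x + b * b * comp g c 1 1 x := by
    intro a b hab
    have hv : a • coordFrame c 0 x + b • coordFrame c 1 x ≠ 0 := by
      intro h0
      have h1 : ∀ i, coord c i x (a • coordFrame c 0 x + b • coordFrame c 1 x) = 0 := by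
        intro i; rw [h0]; simp [coord]
      simp only [coord_add, coord_smul, coord_coordFrame hx] at h1
      have := h1 0; have := h1 1
      simp_all
    have := hg.pos x _ hv
    simp only [hg.add_left, hg.add_right, hg.smul_left, hg.smul_right] at this
    have hsymm := hg.comp_symm c x
    simp only [comp] at *
    rw [hsymm] at this
    linarith
  -- The Gram form takes the value `g₀₀ det g` at `(-g₀₁, g₀₀)`.
  have h0 := key 1 0 (by simp)
  have h1 := key (-comp g c 0 1 x) (comp g c 0 0 x) (Or.inr (by simp at h0; exact h0.ne'))
  simp at h0
  have h2 : 0 < comp g c 0 0 x * (comp g c 0 0 x * comp g c 1 1 x -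
    comp g c 0 1 x * comp g c 0 1 x) := by linarith
  exact (mul_pos_iff_of_pos_left h0).1 h2

lemma vol_pos (hx : x ∈ (chartAt 𝔼 c).source) : 0 < vol g c x := Real.sqrt_pos.2 (hg.det_pos hx)

lemma vol_sq (hx : x ∈ (chartAt 𝔼 c).source) : vol g c x ^ 2 =
    comp g c 0 0 x * comp g c 1 1 x - comp g c 0 1 x ^ 2 := by
  rw [vol, Real.sq_sqrt (hg.det_pos hx).le, det_gram, hg.comp_symm]; ring

lemma smoothNear_det (hx : x ∈ (chartAt 𝔼 c).source) :
    SmoothNear (fun y => (gram g c y).det) x := by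
  simp only [det_gram]
  exact ((hg.smoothNear_comp hx 0 0).mul (hg.smoothNear_comp hx 1 1)).sub
    ((hg.smoothNear_comp hx 0 1).mul (hg.smoothNear_comp hx 1 0))

lemma smoothNear_vol (hx : x ∈ (chartAt 𝔼 c).source) : SmoothNear (vol g c) x :=
  (hg.smoothNear_det hx).sqrt (hg.det_pos hx)

lemma gInv_eq (hx : x ∈ (chartAt 𝔼 c).source) :
    gInv g c 0 0 x = comp g c 1 1 x / vol g c x ^ 2 ∧
    gInv g c 0 1 x = -comp g c 0 1 x / vol g c x ^ 2 ∧
    gInv g c 1 0 x = -comp g c 0 1 x / vol g c x ^ 2 ∧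
    gInv g c 1 1 x = comp g c 0 0 x / vol g c x ^ 2 := by
  have h : vol g c x ^ 2 = (gram g c x).det := Real.sq_sqrt (hg.det_pos hx).le
  rw [h]
  have hs := hg.comp_symm c x
  simp only [gInv, Matrix.inv_def, Matrix.adjugate_fin_two, Ring.inverse_eq_inv']
  simp only [gram, Matrix.smul_apply, Matrix.of_apply, smul_eq_mul]
  simp [div_eq_inv_mul, hs]

lemma smoothNear_gInv (hx : x ∈ (chartAt 𝔼 c).source) (i j : Fin 2) :
    SmoothNear (gInv g c i j) x := by
  have hv := (hg.smoothNear_vol hx).pow 2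
  have hv0 : vol g c x ^ 2 ≠ 0 := (pow_pos (hg.vol_pos hx) 2).ne'
  have hev := (chart_source_mem_nhds hx).mono fun y hy => hg.gInv_eq hy
  fin_cases i <;> fin_cases j
  · exact ((hg.smoothNear_comp hx 1 1).div hv hv0).congr (hev.mono fun y h => h.1)
  · exact ((hg.smoothNear_comp hx 0 1).neg.div hv hv0).congr (hev.mono fun y h => h.2.1)
  · exact ((hg.smoothNear_comp hx 0 1).neg.div hv hv0).congr (hev.mono fun y h => h.2.2.1)
  · exact ((hg.smoothNear_comp hx 0 0).div hv hv0).congr (hev.mono fun y h => h.2.2.2)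

lemma comp_change (hx' : x ∈ (chartAt 𝔼 c').source) (i j : Fin 2) :
    comp g c i j x = frameChange c' c x 0 i * frameChange c' c x 0 j * comp g c' 0 0 x +
      (frameChange c' c x 0 i * frameChange c' c x 1 j +
        frameChange c' c x 1 i * frameChange c' c x 0 j) * comp g c' 0 1 x +
      frameChange c' c x 1 i * frameChange c' c x 1 j * comp g c' 1 1 x := by
  have hs := hg.comp_symm c' x
  unfold comp at *
  rw [coordFrame_change (c := c) hx' i, coordFrame_change (c := c) hx' j]
  simp only [hg.add_left, hg.add_right, hg.smul_left, hg.smul_right, hs]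
  ring

lemma vol_change (hx' : x ∈ (chartAt 𝔼 c').source) :
    vol g c x = |jac c' c x| * vol g c' x := by
  have h : (gram g c x).det = jac c' c x ^ 2 * (gram g c' x).det := by
    simp only [det_gram, hg.comp_symm, hg.comp_change (c := c) hx', jac]; ring
  rw [vol, h, Real.sqrt_mul (sq_nonneg _), Real.sqrt_sq_eq_abs]; rfl

end IsSmoothMetric

/-! ### Gradients, the Hodge star of a differential and the Laplacian -/

/-- The inner product `⟨df, dh⟩_g`, computed in the chart around `c`. -/
def dInner (g : TensorField₂ M) (c : M) (f h : M → ℝ) (x : M) : ℝ :=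
  ∑ i, ∑ j, gInv g c i j x * pd c i f x * pd c j h x

/-- The Hodge star of `dh`, that is the one-form `v ↦ vol_g(∇h, v)`, with respect to the orientation
of the chart around `c`. -/
def starForm (g : TensorField₂ M) (c : M) (h : M → ℝ) (x : M) (v : TangentSpace (𝓡 2) x) : ℝ :=
  vol g c x * ((∑ i, gInv g c 0 i x * pd c i h x) * coord c 1 x v -
    (∑ i, gInv g c 1 i x * pd c i h x) * coord c 0 x v)

/-- The Laplacian, computed in the chart around `c`. -/
def lapIn (g : TensorField₂ M) (c : M) (h : M → ℝ) (x : M) : ℝ :=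
  (vol g c x)⁻¹ * ∑ i, pd c i (fun y => vol g c y * ∑ j, gInv g c i j y * pd c j h y) x

lemma laplacian_eq_lapIn (g : TensorField₂ M) (h : M → ℝ) (x : M) :
    laplacian g h x = lapIn g x h x := rfl

lemma dNormSq_eq_dInner (g : TensorField₂ M) (h : M → ℝ) (x : M) :
    dNormSq g h x = dInner g x h h x := rfl

lemma isLinearMap_starForm (g : TensorField₂ M) (c : M) (h : M → ℝ) (x : M) :
    IsLinearMap ℝ (starForm g c h x) := by
  constructor
  · intro v w; simp only [starForm, coord_add]; ring
  · intro a v; simp only [starForm, coord_smul, smul_eq_mul]; ring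

lemma starForm_coordFrame (g : TensorField₂ M) (h : M → ℝ) (hx : x ∈ (chartAt 𝔼 c).source) :
    starForm g c h x (coordFrame c 1 x) = vol g c x * ∑ i, gInv g c 0 i x * pd c i h x ∧
    starForm g c h x (coordFrame c 0 x) = -(vol g c x * ∑ i, gInv g c 1 i x * pd c i h x) := by
  simp only [starForm, coord_coordFrame hx]
  constructor
  · simp
  · simp; ring

lemma IsSmoothMetric.dInner_eq (hg : IsSmoothMetric g) (hx : x ∈ (chartAt 𝔼 c).source)
    (f h : M → ℝ) : dInner g c f h x = (comp g c 1 1 x * pd c 0 f x * pd c 0 h x -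
      comp g c 0 1 x * (pd c 0 f x * pd c 1 h x + pd c 1 f x * pd c 0 h x) +
      comp g c 0 0 x * pd c 1 f x * pd c 1 h x) / vol g c x ^ 2 := by
  obtain ⟨h00, h01, h10, h11⟩ := hg.gInv_eq hx
  simp only [dInner, Fin.sum_univ_two, h00, h01, h10, h11]; ring

lemma IsSmoothMetric.starForm_eq (hg : IsSmoothMetric g) (hx : x ∈ (chartAt 𝔼 c).source)
    (h : M → ℝ) (v : TangentSpace (𝓡 2) x) : starForm g c h x v =
      ((comp g c 1 1 x * pd c 0 h x - comp g c 0 1 x * pd c 1 h x) * coord c 1 x v -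
      (comp g c 0 0 x * pd c 1 h x - comp g c 0 1 x * pd c 0 h x) * coord c 0 x v)
        / vol g c x := by
  obtain ⟨h00, h01, h10, h11⟩ := hg.gInv_eq hx
  have := (hg.vol_pos hx).ne'
  simp only [starForm, Fin.sum_univ_two, h00, h01, h10, h11]
  field_simp
  ring

lemma IsSmoothMetric.dInner_change (hg : IsSmoothMetric g) (hx : x ∈ (chartAt 𝔼 c).source)
    (hx' : x ∈ (chartAt 𝔼 c').source) {f h : M → ℝ}
    (hf : MDifferentiableAt (𝓡 2) 𝓘(ℝ, ℝ) f x) (hh : MDifferentiableAt (𝓡 2) 𝓘(ℝ, ℝ) h x) :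
    dInner g c f h x = dInner g c' f h x := by
  have h1 : vol g c x ^ 2 = jac c' c x ^ 2 * vol g c' x ^ 2 := by
    rw [hg.vol_change (c := c) hx', mul_pow, sq_abs]
  rw [hg.dInner_eq hx, hg.dInner_eq hx', h1]
  simp only [pd_change hx hx' hf, pd_change hx hx' hh, hg.comp_change (c := c) hx']
  have hj := jac_ne_zero hx hx'
  have hv := (hg.vol_pos hx').ne'
  rw [div_eq_div_iff (by positivity) (by positivity)]
  simp only [jac]
  ring

/-- Under a change of charts the Hodge star changes by the sign of the Jacobian. -/
lemma IsSmoothMetric.starForm_change (hg : IsSmoothMetric g) (hx : x ∈ (chartAt 𝔼 c).source)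
    (hx' : x ∈ (chartAt 𝔼 c').source) {h : M → ℝ}
    (hh : MDifferentiableAt (𝓡 2) 𝓘(ℝ, ℝ) h x) (v : TangentSpace (𝓡 2) x) :
    starForm g c h x v = SignType.sign (jac c' c x) * starForm g c' h x v := by
  rw [hg.starForm_eq hx, hg.starForm_eq hx', hg.vol_change (c := c) hx']
  have hj := jac_ne_zero hx hx'
  have hv := (hg.vol_pos hx').ne'
  have hc : ∀ k, coord c' k x v = frameChange c' c x k 0 * coord c 0 x v +
      frameChange c' c x k 1 * coord c 1 x v := by
    intro k
    conv_lhs => rw [sum_coord_smul_coordFrame hx v]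
    rw [coord_add, coord_smul, coord_smul]
    unfold frameChange; ring
  have hN : ((comp g c 1 1 x * pd c 0 h x - comp g c 0 1 x * pd c 1 h x) * coord c 1 x v -
      (comp g c 0 0 x * pd c 1 h x - comp g c 0 1 x * pd c 0 h x) * coord c 0 x v) =
      jac c' c x * ((comp g c' 1 1 x * pd c' 0 h x - comp g c' 0 1 x * pd c' 1 h x) *
        coord c' 1 x v -
      (comp g c' 0 0 x * pd c' 1 h x - comp g c' 0 1 x * pd c' 0 h x) * coord c' 0 x v) := by
    simp only [hc, pd_change hx hx' hh, hg.comp_change (c := c) hx', jac]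
    ring
  rw [hN]
  rcases lt_or_gt_of_ne hj with h0 | h0
  · rw [abs_of_neg h0, sign_neg h0]
    simp only [SignType.coe_neg, SignType.coe_one]
    field_simp
  · rw [abs_of_pos h0, sign_pos h0]
    simp only [SignType.coe_one]
    field_simp

lemma IsSmoothMetric.smoothNear_sum_gInv_pd (hg : IsSmoothMetric g)
    (hx : x ∈ (chartAt 𝔼 c).source) {h : M → ℝ} (hh : SmoothNear h x) (i : Fin 2) :
    SmoothNear (fun y => vol g c y * ∑ j, gInv g c i j y * pd c j h y) x :=
  (hg.smoothNear_vol hx).mul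
    (SmoothNear.sum fun j _ => (hg.smoothNear_gInv hx i j).mul (hh.pd hx j))

lemma IsSmoothMetric.smoothNear_starForm (hg : IsSmoothMetric g)
    (hx : x ∈ (chartAt 𝔼 c).source) {h : M → ℝ} (hh : SmoothNear h x) (l : Fin 2) :
    SmoothNear (fun y => starForm g c h y (coordFrame c l y)) x := by
  fin_cases l
  · refine (hg.smoothNear_sum_gInv_pd hx hh 1).neg.congr ?_
    filter_upwards [chart_source_mem_nhds hx] with y hy using (starForm_coordFrame g h hy).2
  · refine (hg.smoothNear_sum_gInv_pd hx hh 0).congr ?_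
    filter_upwards [chart_source_mem_nhds hx] with y hy using (starForm_coordFrame g h hy).1

/-- `d ⋆ dh = Δh dV`. -/
lemma IsSmoothMetric.curl_starForm (hg : IsSmoothMetric g) (hx : x ∈ (chartAt 𝔼 c).source)
    (h : M → ℝ) : curl c (starForm g c h) x = vol g c x * lapIn g c h x := by
  have h1 : (fun y => starForm g c h y (coordFrame c 1 y)) =ᶠ[𝓝 x]
      fun y => vol g c y * ∑ i, gInv g c 0 i y * pd c i h y := by
    filter_upwards [chart_source_mem_nhds hx] with y hy using (starForm_coordFrame g h hy).1
  have h0 : (fun y => starForm g c h y (coordFrame c 0 y)) =ᶠ[𝓝 x]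
      fun y => -(vol g c y * ∑ i, gInv g c 1 i y * pd c i h y) := by
    filter_upwards [chart_source_mem_nhds hx] with y hy using (starForm_coordFrame g h hy).2
  rw [curl, pd_congr hx h1, pd_congr hx h0, pd_neg, lapIn, Fin.sum_univ_two,
    mul_inv_cancel_left₀ (hg.vol_pos hx).ne']
  ring

lemma pd_const_mul (hx : x ∈ (chartAt 𝔼 c).source) {f : M → ℝ} (hf : SmoothNear f x) (a : ℝ)
    (i : Fin 2) : pd c i (fun y => a * f y) x = a * pd c i f x := by
  rw [pd_mul (smoothNear_const a) hf hx, pd_const]; ring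

/-- The two charts may induce opposite orientations; the sign is locally constant and passes through
the exterior derivative. -/
lemma curl_starForm_change_orientation (hg : IsSmoothMetric g) (hx : x ∈ (chartAt 𝔼 c).source)
    (hx' : x ∈ (chartAt 𝔼 c').source) {h : M → ℝ} (hh : SmoothNear h x) :
    curl c' (starForm g c h) x =
      SignType.sign (jac c' c x) * curl c' (starForm g c' h) x := by
  have key : ∀ l, (fun y => starForm g c h y (coordFrame c' l y)) =ᶠ[𝓝 x] fun y =>
      (SignType.sign (jac c' c x) : ℝ) * starForm g c' h y (coordFrame c' l y) := by
    intro l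
    filter_upwards [chart_source_mem_nhds hx, chart_source_mem_nhds hx', hh.eventually,
      eventually_sign_jac hx hx'] with y h1 h2 h3 h4
    rw [hg.starForm_change h1 h2 h3.mdifferentiableAt, h4]
  rw [curl, pd_congr hx' (key 1), pd_congr hx' (key 0),
    pd_const_mul hx' (hg.smoothNear_starForm hx' hh 1),
    pd_const_mul hx' (hg.smoothNear_starForm hx' hh 0), curl]
  ring

/-- The Laplacian does not depend on the chart: `d ⋆ dh = Δh dV` in both charts, and the sign by
which the two Hodge stars differ turns the Jacobian in `curl_change` into its absolute value. -/
lemma IsSmoothMetric.laplacian_eq (hg : IsSmoothMetric g) (hx : x ∈ (chartAt 𝔼 c).source)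
    {h : M → ℝ} (hh : SmoothNear h x) : laplacian g h x = lapIn g c h x := by
  have hx' := mem_chart_source 𝔼 x
  have h1 := hg.curl_starForm hx h
  have hs := hg.smoothNear_starForm hx hh
  have hl : ∀ᶠ y in 𝓝 x, IsLinearMap ℝ (starForm g c h y) :=
    Eventually.of_forall fun y => isLinearMap_starForm g c h y
  rw [curl_change hl hx hx' (smoothNear_form_change hl hx' hx hs),
    curl_starForm_change_orientation hg hx hx' hh, hg.curl_starForm hx' h,
    hg.vol_change (c := c) hx', ← mul_assoc, mul_comm (jac x c x), sign_mul_self,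
    mul_assoc] at h1
  rw [laplacian_eq_lapIn]
  have h2 := (abs_pos.2 (jac_ne_zero hx hx')).ne'
  have h3 := (hg.vol_pos hx').ne'
  exact mul_left_cancel₀ h3 (mul_left_cancel₀ h2 h1)

lemma IsSmoothMetric.smoothNear_lapIn (hg : IsSmoothMetric g) (hx : x ∈ (chartAt 𝔼 c).source)
    {h : M → ℝ} (hh : SmoothNear h x) : SmoothNear (lapIn g c h) x :=
  ((hg.smoothNear_vol hx).inv (hg.vol_pos hx).ne').mul
    (SmoothNear.sum fun i _ => (hg.smoothNear_sum_gInv_pd hx hh i).pd hx i)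

lemma IsSmoothMetric.smoothNear_laplacian (hg : IsSmoothMetric g) {h : M → ℝ}
    (hh : SmoothNear h x) : SmoothNear (laplacian g h) x := by
  refine (hg.smoothNear_lapIn (mem_chart_source 𝔼 x) hh).congr ?_
  filter_upwards [chart_source_mem_nhds (mem_chart_source 𝔼 x), hh.eventually] with y h1 h2
    using hg.laplacian_eq h1 h2

lemma IsSmoothMetric.dInner_eq_self (hg : IsSmoothMetric g) (hx : x ∈ (chartAt 𝔼 c).source)
    {f h : M → ℝ} (hf : SmoothNear f x) (hh : SmoothNear h x) :
    dInner g x f h x = dInner g c f h x :=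
  hg.dInner_change (mem_chart_source 𝔼 x) hx hf.mdifferentiableAt hh.mdifferentiableAt

lemma IsSmoothMetric.smoothNear_dInner_self (hg : IsSmoothMetric g) {f h : M → ℝ}
    (hf : SmoothNear f x) (hh : SmoothNear h x) :
    SmoothNear (fun y => dInner g y f h y) x := by
  have hx := mem_chart_source 𝔼 x
  have h1 : SmoothNear (dInner g x f h) x := SmoothNear.sum fun i _ => SmoothNear.sum fun j _ =>
    ((hg.smoothNear_gInv hx i j).mul (hf.pd hx i)).mul (hh.pd hx j)
  refine h1.congr ?_
  filter_upwards [chart_source_mem_nhds hx, hf.eventually, hh.eventually] with y h1 h2 h3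
    using hg.dInner_eq_self h1 h2 h3

lemma IsSmoothMetric.dInner_self_nonneg (hg : IsSmoothMetric g)
    (hx : x ∈ (chartAt 𝔼 c).source) (f : M → ℝ) : 0 ≤ dInner g c f f x := by
  have hnn : ∀ v, 0 ≤ g x v v := by
    intro v
    by_cases hv : v = 0
    · have := hg.smul_left x 0 v v
      rw [zero_smul, zero_mul] at this
      rw [hv] at this ⊢
      exact this.ge
    · exact (hg.pos x v hv).le
  -- `det g · |df|²` is the square norm of the vector `∂₁f ∂₀ - ∂₀f ∂₁`.
  have h := hnn (pd c 1 f x • coordFrame c 0 x + (-pd c 0 f x) • coordFrame c 1 x)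
  simp only [hg.add_left, hg.add_right, hg.smul_left, hg.smul_right] at h
  have hs := hg.comp_symm c x
  rw [hg.dInner_eq hx]
  refine div_nonneg ?_ (sq_nonneg _)
  unfold comp at *
  rw [hs] at h
  linarith

/-! ### Metrics given by sections, and conformal metrics -/

lemma contMDiffOn_coordFrame (c : M) (i : Fin 2) :
    ContMDiffOn (𝓡 2) ((𝓡 2).prod 𝓘(ℝ, 𝔼)) ∞
      (fun x => TotalSpace.mk' 𝔼 x (coordFrame c i x)) (chartAt 𝔼 c).source := by
  have h1 := (trivializationAt 𝔼 (TangentSpace (𝓡 2) (M := M)) c).contMDiffOn_symm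
    (IB := 𝓡 2) (n := ∞)
  have h2 : ContMDiffOn (𝓡 2) ((𝓡 2).prod 𝓘(ℝ, 𝔼)) ∞
      (fun x : M => (x, (EuclideanSpace.single i 1 : 𝔼))) (chartAt 𝔼 c).source :=
    contMDiffOn_id.prodMk contMDiffOn_const
  refine (h1.comp h2 ?_).congr ?_
  · intro x hx
    rw [mem_preimage, Trivialization.mem_target]
    exact mem_baseSet_tangent hx
  · intro x hx
    have hb := mem_baseSet_tangent hx
    unfold coordFrame
    rw [Trivialization.symmL_apply _ hb]
    exact Trivialization.mk_symm _ hb _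

lemma isSmoothMetric_ofMetric (g : ContMDiffRiemannianMetric (𝓡 2) ∞ 𝔼
    (fun x : M => TangentSpace (𝓡 2) x)) : IsSmoothMetric (ofMetric g) where
  add_left x v v' w := by simp [ofMetric]
  smul_left x a v w := by simp [ofMetric]
  symm x v w := g.symm x v w
  pos x v hv := g.pos x v hv
  smooth c i j := by
    have h : ContMDiffOn (𝓡 2) ((𝓡 2).prod 𝓘(ℝ, ℝ)) ∞
        (fun m => TotalSpace.mk' ℝ (E := Bundle.Trivial M ℝ) m
          (g.inner m (coordFrame c i m) (coordFrame c j m))) (chartAt 𝔼 c).source :=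
      ContMDiffOn.clm_bundle_apply₂ (F₁ := 𝔼) (F₂ := 𝔼) g.contMDiff.contMDiffOn
        (contMDiffOn_coordFrame c i) (contMDiffOn_coordFrame c j)
    intro x hx
    exact (Bundle.contMDiffWithinAt_totalSpace.1 (h x hx)).2

lemma comp_conformal (u : M → ℝ) (g : TensorField₂ M) (c : M) (i j : Fin 2) (x : M) :
    comp (conformal u g) c i j x = Real.exp (u x) * comp g c i j x := rfl

lemma IsSmoothMetric.conformal (hg : IsSmoothMetric g) {u : M → ℝ}
    (hu : ContMDiff (𝓡 2) 𝓘(ℝ, ℝ) ∞ u) : IsSmoothMetric (conformal u g) where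
  add_left x v v' w := by simp only [RYM.conformal, hg.add_left]; ring
  smul_left x a v w := by simp only [RYM.conformal, hg.smul_left]; ring
  symm x v w := by simp only [RYM.conformal, hg.symm x v w]
  pos x v hv := mul_pos (Real.exp_pos _) (hg.pos x v hv)
  smooth c i j := contMDiffOn_of_smoothNear fun x hx =>
    (smoothNear_of_contMDiff hu x).exp.mul (hg.smoothNear_comp hx i j)

lemma vol_conformal (u : M → ℝ) (g : TensorField₂ M) (c x : M) :
    vol (conformal u g) c x = Real.exp (u x) * vol g c x := by
  have : (gram (conformal u g) c x).det = Real.exp (u x) ^ 2 * (gram g c x).det := by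
    simp only [det_gram, comp_conformal]; ring
  rw [vol, this, Real.sqrt_mul (sq_nonneg _), Real.sqrt_sq (Real.exp_pos _).le]; rfl

lemma starForm_conformal (hg : IsSmoothMetric g) {u : M → ℝ} (hu : ContMDiff (𝓡 2) 𝓘(ℝ, ℝ) ∞ u)
    (hx : x ∈ (chartAt 𝔼 c).source) (h : M → ℝ) (v : TangentSpace (𝓡 2) x) :
    starForm (conformal u g) c h x v = starForm g c h x v := by
  rw [(hg.conformal hu).starForm_eq hx, hg.starForm_eq hx, vol_conformal]
  simp only [comp_conformal]
  have := (Real.exp_pos (u x)).ne'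
  have := (hg.vol_pos hx).ne'
  field_simp

lemma dInner_conformal (hg : IsSmoothMetric g) {u : M → ℝ} (hu : ContMDiff (𝓡 2) 𝓘(ℝ, ℝ) ∞ u)
    (hx : x ∈ (chartAt 𝔼 c).source) (f h : M → ℝ) :
    Real.exp (u x) * dInner (conformal u g) c f h x = dInner g c f h x := by
  rw [(hg.conformal hu).dInner_eq hx, hg.dInner_eq hx, vol_conformal]
  simp only [comp_conformal]
  have := (Real.exp_pos (u x)).ne'
  have := (hg.vol_pos hx).ne'
  field_simp

end Metric

section TwoForms

variable {M : Type*} [TopologicalSpace M] [ChartedSpace (EuclideanSpace ℝ (Fin 2)) M]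
  [IsManifold (𝓡 2) ∞ M] {c c' x : M} {g F : TensorField₂ M}

/-! ### Two-forms on a Riemannian surface -/

/-- The function `f = F₀₁ / (det g)^{1/2}` with `F = f dV_g`, with respect to the orientation of the
chart around `c`. -/
def density (g F : TensorField₂ M) (c x : M) : ℝ := comp F c 0 1 x / vol g c x

/-- The components of the tensor field `F` are skew-symmetric. -/
def IsSkew (F : TensorField₂ M) : Prop := ∀ c i j x, comp F c i j x = -comp F c j i x

lemma IsSkew.comp_self (hF : IsSkew F) (c : M) (i : Fin 2) (x : M) : comp F c i i x = 0 := by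
  have := hF c i i x; linarith

lemma IsSmoothMetric.smoothNear_density (hg : IsSmoothMetric g) (hx : x ∈ (chartAt 𝔼 c).source)
    (hs : SmoothNear (comp F c 0 1) x) : SmoothNear (density g F c) x :=
  hs.div (hg.smoothNear_vol hx) (hg.vol_pos hx).ne'

/-- `|F|² = 2 f²`. -/
lemma normSq_eq (hg : IsSmoothMetric g) (hF : IsSkew F) (x : M) :
    normSq g F x = 2 * density g F x x ^ 2 := by
  have hx := mem_chart_source 𝔼 x
  obtain ⟨h00, h01, h10, h11⟩ := hg.gInv_eq hx
  have hv := (hg.vol_pos hx).ne'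
  have hv2 := hg.vol_sq hx
  simp only [normSq, Fin.sum_univ_two, hF.comp_self, hF x 1 0, h00, h01, h10, h11, density]
  field_simp
  rw [hv2]
  ring

/-- The trace of the Christoffel symbols is the logarithmic derivative of the volume density. -/
lemma IsSmoothMetric.sum_christoffel (hg : IsSmoothMetric g) (hx : x ∈ (chartAt 𝔼 c).source)
    (k : Fin 2) : (christoffel g c 0 k 0 x + christoffel g c 1 k 1 x) * vol g c x =
      pd c k (vol g c) x := by
  obtain ⟨h00, h01, h10, h11⟩ := hg.gInv_eq hx
  have hv := (hg.vol_pos hx).ne'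
  have hv2 := hg.vol_sq hx
  have hs : comp g c 1 0 = comp g c 0 1 := funext fun y => hg.comp_symm c y
  have hd : 2 * vol g c x * pd c k (vol g c) x =
      comp g c 0 0 x * pd c k (comp g c 1 1) x + comp g c 1 1 x * pd c k (comp g c 0 0) x -
        2 * comp g c 0 1 x * pd c k (comp g c 0 1) x := by
    have e : (fun y => vol g c y * vol g c y) =ᶠ[𝓝 x] fun y =>
        comp g c 0 0 y * comp g c 1 1 y - comp g c 0 1 y * comp g c 0 1 y := by
      filter_upwards [chart_source_mem_nhds hx] with y hy
      have := hg.vol_sq hy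
      linear_combination this
    have h1 := pd_congr hx e k
    have s := fun i j => hg.smoothNear_comp hx i j
    rw [pd_mul (hg.smoothNear_vol hx) (hg.smoothNear_vol hx) hx,
      pd_sub ((s 0 0).mul (s 1 1)) ((s 0 1).mul (s 0 1)) hx, pd_mul (s 0 0) (s 1 1) hx,
      pd_mul (s 0 1) (s 0 1) hx] at h1
    linear_combination h1
  have hd' : pd c k (vol g c) x = (comp g c 0 0 x * pd c k (comp g c 1 1) x +
      comp g c 1 1 x * pd c k (comp g c 0 0) x -
        2 * comp g c 0 1 x * pd c k (comp g c 0 1) x) / (2 * vol g c x) := by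
    rw [← hd]; field_simp
  rw [hd']
  fin_cases k <;>
  · simp only [christoffel, Fin.sum_univ_two, h00, h01, h10, h11, hs, Fin.zero_eta, Fin.mk_one]
    field_simp
    ring

lemma IsSmoothMetric.pd_density (hg : IsSmoothMetric g) (hx : x ∈ (chartAt 𝔼 c).source)
    (hs : SmoothNear (comp F c 0 1) x) (k : Fin 2) :
    pd c k (comp F c 0 1) x =
      vol g c x * pd c k (density g F c) x + density g F c x * pd c k (vol g c) x := by
  have e : comp F c 0 1 =ᶠ[𝓝 x] fun y => vol g c y * density g F c y := by
    filter_upwards [chart_source_mem_nhds hx] with y hy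
    have := (hg.vol_pos hy).ne'
    rw [density]; field_simp
  rw [pd_congr hx e, pd_mul (hg.smoothNear_vol hx) (hg.smoothNear_density hx hs) hx]

/-- `∇(f dV) = df ⊗ dV`. -/
lemma nabla_eq (hg : IsSmoothMetric g) (hF : IsSkew F) (hx : x ∈ (chartAt 𝔼 c).source)
    (hs : SmoothNear (comp F c 0 1) x) (k : Fin 2) :
    nabla g F c k 0 1 x = vol g c x * pd c k (density g F c) x ∧
    nabla g F c k 1 0 x = -(vol g c x * pd c k (density g F c) x) ∧
    nabla g F c k 0 0 x = 0 ∧ nabla g F c k 1 1 x = 0 := by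
  have hv := (hg.vol_pos hx).ne'
  have h1 := hg.sum_christoffel hx k
  have h2 := hg.pd_density hx hs k
  have h3 : density g F c x * vol g c x = comp F c 0 1 x := by
    rw [density]; field_simp
  have hsk : comp F c 1 0 = fun y => -comp F c 0 1 y := funext fun y => hF c 1 0 y
  have hsk0 : ∀ i, comp F c i i = fun _ => 0 := fun i => funext fun y => hF.comp_self c i y
  simp only [nabla, Fin.sum_univ_two, hsk, hsk0, pd_neg, pd_const]
  refine ⟨?_, ?_, ?_, ?_⟩
  · linear_combination h2 - density g F c x * h1 +
      (christoffel g c 0 k 0 x + christoffel g c 1 k 1 x) * h3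
  · linear_combination -(h2 - density g F c x * h1 +
      (christoffel g c 0 k 0 x + christoffel g c 1 k 1 x) * h3)
  · ring
  · ring

/-- `|∇(f dV)|² = 2 |df|²`. -/
lemma nablaNormSq_eq (hg : IsSmoothMetric g) (hF : IsSkew F)
    (hs : SmoothNear (comp F x 0 1) x) :
    nablaNormSq g F x = 2 * dInner g x (density g F x) (density g F x) x := by
  have hx := mem_chart_source 𝔼 x
  obtain ⟨h00, h01, h10, h11⟩ := hg.gInv_eq hx
  have hv := (hg.vol_pos hx).ne'
  have hv2 := hg.vol_sq hx
  have hN := fun k => nabla_eq hg hF hx hs k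
  have hdet : gInv g x 0 0 x * gInv g x 1 1 x - gInv g x 0 1 x * gInv g x 1 0 x =
      1 / vol g x x ^ 2 := by
    rw [h00, h01, h10, h11]; field_simp; linear_combination -hv2
  have hsy : gInv g x 1 0 x = gInv g x 0 1 x := h10.trans h01.symm
  rw [hsy] at hdet
  have hdet' : (gInv g x 0 0 x * gInv g x 1 1 x - gInv g x 0 1 x * gInv g x 0 1 x) *
      vol g x x ^ 2 = 1 := by rw [hdet]; field_simp
  simp only [nablaNormSq, dInner, Fin.sum_univ_two, (hN _).1, (hN _).2.1, (hN _).2.2.1,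
    (hN _).2.2.2, hsy]
  linear_combination (2 * (gInv g x 0 0 x * pd x 0 (density g F x) x * pd x 0 (density g F x) x +
    2 * gInv g x 0 1 x * pd x 0 (density g F x) x * pd x 1 (density g F x) x +
    gInv g x 1 1 x * pd x 1 (density g F x) x * pd x 1 (density g F x) x)) * hdet'

/-- `-d^*(f dV) = ⋆df`. -/
lemma neg_codiff_eq (hg : IsSmoothMetric g) (hF : IsSkew F)
    (hs : SmoothNear (comp F x 0 1) x) (v : TangentSpace (𝓡 2) x) :
    -codiff g F x v = starForm g x (density g F x) x v := by
  have hx := mem_chart_source 𝔼 x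
  obtain ⟨h00, h01, h10, h11⟩ := hg.gInv_eq hx
  have hN := fun k => nabla_eq hg hF hx hs k
  have hsy : gInv g x 1 0 x = gInv g x 0 1 x := h10.trans h01.symm
  simp only [codiff, starForm, Fin.sum_univ_two, (hN _).1, (hN _).2.1, (hN _).2.2.1,
    (hN _).2.2.2, hsy]
  ring

/-- `F` is a smooth two-form: its components are skew-symmetric and smooth, and `F₀₁` is multiplied
by the Jacobian under a change of charts. -/
def IsTwoForm (F : TensorField₂ M) : Prop :=
  IsSkew F ∧ (∀ c, ∀ x ∈ (chartAt 𝔼 c).source, SmoothNear (comp F c 0 1) x) ∧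
    ∀ c c', ∀ x ∈ (chartAt 𝔼 c).source, x ∈ (chartAt 𝔼 c').source →
      comp F c 0 1 x = jac c' c x * comp F c' 0 1 x

lemma IsTwoForm.density_change (hF : IsTwoForm F) (hg : IsSmoothMetric g)
    (hx : x ∈ (chartAt 𝔼 c).source) (hx' : x ∈ (chartAt 𝔼 c').source) :
    density g F c x = SignType.sign (jac c' c x) * density g F c' x := by
  rw [density, density, hF.2.2 c c' x hx hx', hg.vol_change (c := c) hx']
  have hj := jac_ne_zero hx hx'
  have hv := (hg.vol_pos hx').ne'
  rcases lt_or_gt_of_ne hj with h0 | h0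
  · rw [abs_of_neg h0, sign_neg h0]
    simp only [SignType.coe_neg, SignType.coe_one]
    field_simp
  · rw [abs_of_pos h0, sign_pos h0]
    simp only [SignType.coe_one]
    field_simp

lemma sign_sq_cast {a : ℝ} (ha : a ≠ 0) :
    ((SignType.sign a : SignType) : ℝ) * (SignType.sign a : SignType) = 1 := by
  rcases lt_or_gt_of_ne ha with h | h
  · rw [sign_neg h]; simp
  · rw [sign_pos h]; simp

lemma IsTwoForm.normSq_eq (hF : IsTwoForm F) (hg : IsSmoothMetric g)
    (hx : x ∈ (chartAt 𝔼 c).source) : normSq g F x = 2 * density g F c x ^ 2 := by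
  have hx' := mem_chart_source 𝔼 x
  rw [RYM.normSq_eq hg hF.1, hF.density_change hg hx' hx]
  linear_combination 2 * density g F c x ^ 2 * sign_sq_cast (jac_ne_zero hx' hx)

lemma starForm_congr (hx : x ∈ (chartAt 𝔼 c).source) {f h : M → ℝ} (e : f =ᶠ[𝓝 x] h)
    (v : TangentSpace (𝓡 2) x) : starForm g c f x v = starForm g c h x v := by
  simp only [starForm, pd_congr hx e]

lemma starForm_const_mul (hx : x ∈ (chartAt 𝔼 c).source) {f : M → ℝ} (hf : SmoothNear f x)
    (a : ℝ) (v : TangentSpace (𝓡 2) x) :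
    starForm g c (fun y => a * f y) x v = a * starForm g c f x v := by
  simp only [starForm, pd_const_mul hx hf, Fin.sum_univ_two]; ring

/-- `-d^*F = ⋆df` in an arbitrary chart: the signs in the changes of `f` and of the Hodge star
cancel. -/
lemma IsTwoForm.neg_codiff (hF : IsTwoForm F) (hg : IsSmoothMetric g)
    (hx : x ∈ (chartAt 𝔼 c).source) (v : TangentSpace (𝓡 2) x) :
    -codiff g F x v = starForm g c (density g F c) x v := by
  have hx' := mem_chart_source 𝔼 x
  have hs := hg.smoothNear_density hx (hF.2.1 c x hx)
  have e : density g F x =ᶠ[𝓝 x] fun y => (SignType.sign (jac c x x) : ℝ) * density g F c y := by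
    filter_upwards [chart_source_mem_nhds hx, chart_source_mem_nhds hx',
      eventually_sign_jac hx' hx] with y h1 h2 h3
    rw [hF.density_change hg h2 h1, h3]
  rw [neg_codiff_eq hg hF.1 (hF.2.1 x x hx'), starForm_congr hx' e, starForm_const_mul hx' hs,
    hg.starForm_change hx' hx hs.mdifferentiableAt, ← mul_assoc,
    sign_sq_cast (jac_ne_zero hx' hx), one_mul]

end TwoForms

/-! ### The curvature of a connection -/

section Curvature

variable {ι M : Type*} [TopologicalSpace M] [ChartedSpace (EuclideanSpace ℝ (Fin 2)) M]
  [IsManifold (𝓡 2) ∞ M] {c c' x : M} {L : U1Bundle ι M}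

lemma U1Bundle.smoothNear_transition (L : U1Bundle ι M) {i j : ι}
    (hx : x ∈ L.baseSet i ∩ L.baseSet j) (ℓ : ℂ →L[ℝ] ℝ) :
    SmoothNear (fun y => ℓ (L.transition i j y : ℂ)) x := by
  refine smoothNear_of_contMDiffOn ((L.isOpen_baseSet i).inter (L.isOpen_baseSet j)) ?_ hx
  exact (contMDiff_iff_contDiff.2 ℓ.contDiff).comp_contMDiffOn (L.contMDiffOn_transition i j)

/-- The linear map `ℓ` stands for the real or the imaginary part. -/
lemma U1Bundle.dTransition_coordFrame (L : U1Bundle ι M) {i j : ι}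
    (hx : x ∈ L.baseSet i ∩ L.baseSet j) (hc : x ∈ (chartAt 𝔼 c).source) (ℓ : ℂ →L[ℝ] ℝ)
    (k : Fin 2) : ℓ (L.dTransition i j x (coordFrame c k x)) =
      pd c k (fun y => ℓ (L.transition i j y : ℂ)) x := by
  rw [pd_eq_mfderiv hc (L.smoothNear_transition hx ℓ).mdifferentiableAt]
  have h1 : MDifferentiableAt (𝓡 2) 𝓘(ℝ, ℂ) (fun y => (L.transition i j y : ℂ)) x :=
    ((L.contMDiffOn_transition i j).contMDiffAt
      (((L.isOpen_baseSet i).inter (L.isOpen_baseSet j)).mem_nhds hx)).mdifferentiableAt (by simp)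
  have h2 := mfderiv_comp x (g := ℓ) (I'' := 𝓘(ℝ, ℝ)) ℓ.differentiableAt.mdifferentiableAt h1
  have h4 : (fun y => ℓ (L.transition i j y : ℂ)) =
    ℓ ∘ (fun y => (L.transition i j y : ℂ)) := rfl
  rw [h4, h2, mfderiv_eq_fderiv, ℓ.fderiv]; rfl

namespace Connection

variable (A : Connection L)

lemma smoothNear_form {i : ι} (hx : x ∈ L.baseSet i) (hc : x ∈ (chartAt 𝔼 c).source)
    (k : Fin 2) : SmoothNear (fun y => A.form i y (coordFrame c k y)) x :=
  smoothNear_of_contMDiffOn ((L.isOpen_baseSet i).inter (chartAt 𝔼 c).open_source)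
    (A.smooth_form i c k) ⟨hx, hc⟩

/-- A change of trivialization does not change the exterior derivative of the connection form:
the form `Im(τ̄ dτ) = a db - b da`, `τ = a + √-1 b`, is closed, since `a² + b² = 1` makes
`da` and `db` linearly dependent. -/
lemma curl_form_eq {i j : ι} (hi : x ∈ L.baseSet i) (hj : x ∈ L.baseSet j)
    (hc : x ∈ (chartAt 𝔼 c).source) :
    curl c (fun y v => A.form j y v) x = curl c (fun y v => A.form i y v) x := by
  set a : M → ℝ := fun y => Complex.reCLM (L.transition i j y : ℂ) with ha
  set b : M → ℝ := fun y => Complex.imCLM (L.transition i j y : ℂ) with hb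
  have sa : SmoothNear a x := L.smoothNear_transition ⟨hi, hj⟩ _
  have sb : SmoothNear b x := L.smoothNear_transition ⟨hi, hj⟩ _
  have key : ∀ k, (fun y => A.form j y (coordFrame c k y)) =ᶠ[𝓝 x] fun y =>
      A.form i y (coordFrame c k y) + (a y * pd c k b y - b y * pd c k a y) := by
    intro k
    filter_upwards [((L.isOpen_baseSet i).inter (L.isOpen_baseSet j)).mem_nhds ⟨hi, hj⟩,
      chart_source_mem_nhds hc] with y hy hyc
    rw [A.form_transition i j y hy, hb, ha, ← L.dTransition_coordFrame hy hyc,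
      ← L.dTransition_coordFrame hy hyc, Complex.mul_im]
    simp [sub_eq_add_neg]
  have hab : ∀ y, a y * a y + b y * b y = 1 := by
    intro y
    have := Circle.normSq_coe (L.transition i j y)
    rw [Complex.normSq_apply] at this
    simpa [ha, hb] using this
  have hd : ∀ k, a x * pd c k a x + b x * pd c k b x = 0 := by
    intro k
    have e : (fun y => a y * a y + b y * b y) =ᶠ[𝓝 x] fun _ => 1 :=
      Eventually.of_forall hab
    have := pd_congr hc e k
    rw [pd_add (sa.mul sa) (sb.mul sb) hc, pd_mul sa sa hc, pd_mul sb sb hc, pd_const] at this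
    linarith
  have hz : pd c 0 a x * pd c 1 b x - pd c 0 b x * pd c 1 a x = 0 := by
    -- Multiply by `a² + b² = 1` and use `a da = -b db`.
    have h0 := hd 0
    have h1 := hd 1
    have h2 := hab x
    linear_combination (-(pd c 0 a x * pd c 1 b x - pd c 0 b x * pd c 1 a x)) * h2 +
      (a x * pd c 1 b x - b x * pd c 1 a x) * h0 + (b x * pd c 0 a x - a x * pd c 0 b x) * h1
  have st : ∀ k, SmoothNear (fun y => a y * pd c k b y - b y * pd c k a y) x := fun k =>
    (sa.mul (sb.pd hc k)).sub (sb.mul (sa.pd hc k))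
  have sf := fun k => A.smoothNear_form hi hc k
  unfold curl
  rw [pd_congr hc (key 1), pd_congr hc (key 0), pd_add (sf 1) (st 1) hc, pd_add (sf 0) (st 0) hc,
    pd_sub (sa.mul (sb.pd hc 1)) (sb.mul (sa.pd hc 1)) hc,
    pd_sub (sa.mul (sb.pd hc 0)) (sb.mul (sa.pd hc 0)) hc,
    pd_mul sa (sb.pd hc 1) hc, pd_mul sb (sa.pd hc 1) hc, pd_mul sa (sb.pd hc 0) hc,
    pd_mul sb (sa.pd hc 0) hc, pd_comm sa hc 0 1, pd_comm sb hc 0 1]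
  linear_combination 2 * hz

lemma isLinearMap_form (i : ι) (y : M) : IsLinearMap ℝ (fun v => A.form i y v) :=
  ⟨fun v w => map_add _ v w, fun a v => map_smul _ a v⟩

/-- `F₀₁ = ∂₀ A₁ - ∂₁ A₀` in every chart and every trivialization. -/
lemma comp_curvature {i : ι} (hi : x ∈ L.baseSet i) (hc : x ∈ (chartAt 𝔼 c).source) :
    comp A.curvature c 0 1 x = curl c (fun y v => A.form i y v) x := by
  have h0 := L.mem_baseSet_at x
  have h1 : comp A.curvature c 0 1 x =
      comp (extD (fun y v => A.form (L.indexAt x) y v)) c 0 1 x := rfl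
  rw [h1, comp_extD (Eventually.of_forall fun y => A.isLinearMap_form _ y) hc
    (fun l => A.smoothNear_form h0 (mem_chart_source 𝔼 x) l), A.curl_form_eq hi h0 hc]

lemma isSkew_curvature : IsSkew A.curvature := by
  intro c i j x
  have h : ∀ i j, comp A.curvature c i j x =
      comp (extD (fun y v => A.form (L.indexAt x) y v)) c i j x := fun i j => rfl
  rw [h, h]
  fin_cases i <;> fin_cases j
  · simp [comp_extD_self]
  · simp [comp_extD_swap]
  · simp [comp_extD_swap]
  · simp [comp_extD_self]

lemma isTwoForm_curvature : IsTwoForm A.curvature := by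
  refine ⟨A.isSkew_curvature, fun c x hc => ?_, fun c c' x hc hc' => ?_⟩
  · have h0 := L.mem_baseSet_at x
    have s := fun k => A.smoothNear_form h0 hc k
    refine (((s 1).pd hc 0).sub ((s 0).pd hc 1)).congr ?_
    filter_upwards [chart_source_mem_nhds hc, (L.isOpen_baseSet _).mem_nhds h0] with y h1 h2
      using A.comp_curvature h2 h1
  · have h0 := L.mem_baseSet_at x
    rw [A.comp_curvature h0 hc, A.comp_curvature h0 hc',
      curl_change (Eventually.of_forall fun y => A.isLinearMap_form _ y) hc hc'
        (fun l => A.smoothNear_form h0 hc' l)]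

end Connection

end Curvature

section Volume

variable {M : Type*} [TopologicalSpace M] [ChartedSpace (EuclideanSpace ℝ (Fin 2)) M]
  [IsManifold (𝓡 2) ∞ M] [MeasurableSpace M] [BorelSpace M] {c c' x : M} {g : TensorField₂ M}

/-! ### The Riemannian volume in charts -/

lemma aemeasurable_extChartAt_symm (c : M) : AEMeasurable (extChartAt (𝓡 2) c).symm
    ((volume : Measure 𝔼).restrict (extChartAt (𝓡 2) c).target) :=
  (continuousOn_extChartAt_symm c).aemeasurable (isOpen_extChartAt_target c).measurableSet

lemma measurableSet_chart_preimage (c : M) {A : Set M} (hA : MeasurableSet A) :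
    MeasurableSet ((extChartAt (𝓡 2) c).target ∩ (extChartAt (𝓡 2) c).symm ⁻¹' A) := by
  have h1 := (continuousOn_iff_continuous_domRestrict.1
    (continuousOn_extChartAt_symm (I := 𝓡 2) c)).measurable hA
  have h2 := (isOpen_extChartAt_target (I := 𝓡 2) c).measurableSet.subtype_image h1
  convert h2 using 1
  ext y
  simp [and_comm]

lemma vol_nonneg (g : TensorField₂ M) (c x : M) : 0 ≤ vol g c x := Real.sqrt_nonneg _

lemma chartVolume_eq_map (g : TensorField₂ M) (c : M) : chartVolume g c =
    ((volume.restrict (extChartAt (𝓡 2) c).target).withDensity fun y =>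
      ENNReal.ofReal (vol g c ((extChartAt (𝓡 2) c).symm y))).map (extChartAt (𝓡 2) c).symm := rfl

lemma chartVolume_apply (g : TensorField₂ M) (c : M) {A : Set M} (hA : MeasurableSet A) :
    chartVolume g c A =
      ∫⁻ y in (extChartAt (𝓡 2) c).target ∩ (extChartAt (𝓡 2) c).symm ⁻¹' A,
        ENNReal.ofReal (vol g c ((extChartAt (𝓡 2) c).symm y)) := by
  rw [chartVolume, Measure.map_apply_of_aemeasurable
    ((aemeasurable_extChartAt_symm c).mono_ac (withDensity_absolutelyContinuous _ _)) hA,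
    withDensity_apply', Measure.restrict_restrict' (isOpen_extChartAt_target c).measurableSet,
    inter_comm]
  rfl

lemma differentiableAt_chart_change {y : 𝔼} (hy : y ∈ (extChartAt (𝓡 2) c).target)
    (hy' : (extChartAt (𝓡 2) c).symm y ∈ (chartAt 𝔼 c').source) :
    DifferentiableAt ℝ (fun z => extChartAt (𝓡 2) c' ((extChartAt (𝓡 2) c).symm z)) y := by
  have h1 : ContMDiffAt 𝓘(ℝ, 𝔼) (𝓡 2) ∞ (extChartAt (𝓡 2) c).symm y :=
    (contMDiffOn_extChartAt_symm (I := 𝓡 2) (n := ∞) c).contMDiffAt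
      ((isOpen_extChartAt_target c).mem_nhds hy)
  have h2 : ContMDiffAt (𝓡 2) 𝓘(ℝ, 𝔼) ∞ (extChartAt (𝓡 2) c') ((extChartAt (𝓡 2) c).symm y) :=
    (contMDiffOn_extChartAt (I := 𝓡 2) (n := ∞) (x := c')).contMDiffAt
      ((chartAt 𝔼 c').open_source.mem_nhds hy')
  exact ((h2.comp y h1).contDiffAt).differentiableAt (by simp)

lemma det_fderiv_chart_change {y : 𝔼} (hy : y ∈ (extChartAt (𝓡 2) c).target)
    (hy' : (extChartAt (𝓡 2) c).symm y ∈ (chartAt 𝔼 c').source) :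
    (fderiv ℝ (fun z => extChartAt (𝓡 2) c' ((extChartAt (𝓡 2) c).symm z)) y).det =
      jac c' c ((extChartAt (𝓡 2) c).symm y) := by
  have hd := differentiableAt_chart_change hy hy'
  have key : ∀ k j : Fin 2, (fderiv ℝ (fun z => extChartAt (𝓡 2) c'
      ((extChartAt (𝓡 2) c).symm z)) y (EuclideanSpace.single j 1)) k =
      frameChange c' c ((extChartAt (𝓡 2) c).symm y) k j := by
    intro k j
    rw [frameChange_eq_pd (symm_mem_chart_source hy) hy', pd,
      (extChartAt (𝓡 2) c).right_inv hy]
    have h1 : HasFDerivAt (fun v : 𝔼 => v k) (EuclideanSpace.proj (𝕜 := ℝ) k)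
        (extChartAt (𝓡 2) c' ((extChartAt (𝓡 2) c).symm y)) :=
      (EuclideanSpace.proj (𝕜 := ℝ) k).hasFDerivAt
    have h2 := (h1.comp y hd.hasFDerivAt).fderiv
    have h3 : (fun z => coordFun c' k ((extChartAt (𝓡 2) c).symm z)) = (fun v : 𝔼 => v k) ∘
      (fun z => extChartAt (𝓡 2) c' ((extChartAt (𝓡 2) c).symm z)) := rfl
    rw [h3, h2]; rfl
  rw [ContinuousLinearMap.det,
    ← LinearMap.det_toMatrix (EuclideanSpace.basisFun (Fin 2) ℝ).toBasis, Matrix.det_fin_two]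
  simp only [LinearMap.toMatrix_apply, OrthonormalBasis.coe_toBasis,
    OrthonormalBasis.coe_toBasis_repr_apply, EuclideanSpace.basisFun_apply,
    EuclideanSpace.basisFun_repr, ContinuousLinearMap.coe_coe, key, jac]

/-- The volume measures of two charts agree on the overlap, by the change of variables formula. -/
lemma chartVolume_eq_of_subset (hg : IsSmoothMetric g) {A : Set M} (hA : MeasurableSet A)
    (hc : A ⊆ (chartAt 𝔼 c).source) (hc' : A ⊆ (chartAt 𝔼 c').source) :
    chartVolume g c' A = chartVolume g c A := by
  rw [chartVolume_apply g c hA, chartVolume_apply g c' hA]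
  set s := (extChartAt (𝓡 2) c).target ∩ (extChartAt (𝓡 2) c).symm ⁻¹' A with hs
  set f : 𝔼 → 𝔼 := fun z => extChartAt (𝓡 2) c' ((extChartAt (𝓡 2) c).symm z) with hf
  have himg : (extChartAt (𝓡 2) c').target ∩ (extChartAt (𝓡 2) c').symm ⁻¹' A = f '' s := by
    ext z
    constructor
    · rintro ⟨hz, hzA⟩
      have hzc : (extChartAt (𝓡 2) c').symm z ∈ (extChartAt (𝓡 2) c).source := by
        rw [extChartAt_source]; exact hc hzA
      refine ⟨extChartAt (𝓡 2) c ((extChartAt (𝓡 2) c').symm z),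
        ⟨(extChartAt (𝓡 2) c).map_source hzc, ?_⟩, ?_⟩
      · rwa [mem_preimage, (extChartAt (𝓡 2) c).left_inv hzc]
      · simp only [hf]
        rw [(extChartAt (𝓡 2) c).left_inv hzc, (extChartAt (𝓡 2) c').right_inv hz]
    · rintro ⟨y, ⟨hy, hyA⟩, rfl⟩
      have hyc : (extChartAt (𝓡 2) c).symm y ∈ (extChartAt (𝓡 2) c').source := by
        rw [extChartAt_source]; exact hc' hyA
      exact ⟨(extChartAt (𝓡 2) c').map_source hyc, by
        simp only [hf]; rwa [mem_preimage, (extChartAt (𝓡 2) c').left_inv hyc]⟩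
  have hinj : InjOn f s := by
    rintro y ⟨hy, hyA⟩ z ⟨hz, hzA⟩ hyz
    have hyc : (extChartAt (𝓡 2) c).symm y ∈ (extChartAt (𝓡 2) c').source := by
      rw [extChartAt_source]; exact hc' hyA
    have hzc : (extChartAt (𝓡 2) c).symm z ∈ (extChartAt (𝓡 2) c').source := by
      rw [extChartAt_source]; exact hc' hzA
    exact (extChartAt (𝓡 2) c).symm.injOn hy hz ((extChartAt (𝓡 2) c').injOn hyc hzc hyz)
  rw [himg, lintegral_image_eq_lintegral_abs_det_fderiv_mul volume
    (measurableSet_chart_preimage c hA) (f' := fderiv ℝ f)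
    (fun y hy => (differentiableAt_chart_change hy.1 (hc' hy.2)).hasFDerivAt.hasFDerivWithinAt)
    hinj]
  refine setLIntegral_congr_fun (measurableSet_chart_preimage c hA) fun y hy => ?_
  have hyc : (extChartAt (𝓡 2) c).symm y ∈ (extChartAt (𝓡 2) c').source := by
    rw [extChartAt_source]; exact hc' hy.2
  rw [det_fderiv_chart_change hy.1 (hc' hy.2), (extChartAt (𝓡 2) c').left_inv hyc,
    hg.vol_change (c := c) (hc' hy.2), ENNReal.ofReal_mul (abs_nonneg _)]

lemma chartVolume_compl_source (g : TensorField₂ M) (c : M) :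
    chartVolume g c (chartAt 𝔼 c).sourceᶜ = 0 := by
  rw [chartVolume_apply g c (chartAt 𝔼 c).open_source.measurableSet.compl]
  have : (extChartAt (𝓡 2) c).target ∩
      (extChartAt (𝓡 2) c).symm ⁻¹' (chartAt 𝔼 c).sourceᶜ = ∅ := by
    ext y
    simp only [mem_inter_iff, mem_preimage, mem_compl_iff, mem_empty_iff_false, iff_false, not_and,
      not_not]
    exact fun hy => symm_mem_chart_source hy
  rw [this]; simp

/-- The Riemannian volume restricts to the volume measure of each chart. -/
lemma riemVolume_restrict (hg : IsSmoothMetric g) (c : M) :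
    (riemVolume g).restrict (chartAt 𝔼 c).source = chartVolume g c := by
  have hS : ∀ c : M, MeasurableSet (chartAt 𝔼 c).source :=
    fun c => (chartAt 𝔼 c).open_source.measurableSet
  -- The measure on the right bounds the volume measure of every chart, hence their supremum.
  have hle : riemVolume g ≤
      chartVolume g c + (riemVolume g).restrict (chartAt 𝔼 c).sourceᶜ := by
    refine iSup_le fun c' => ?_
    rw [← Measure.restrict_add_restrict_compl (μ := chartVolume g c') (hS c)]
    refine add_le_add ?_ (Measure.restrict_mono Subset.rfl
      (le_iSup (fun c' => chartVolume g c') c'))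
    refine Measure.le_intro fun A hA _ => ?_
    rw [Measure.restrict_apply hA]
    have h1 : chartVolume g c' (A ∩ (chartAt 𝔼 c).source) =
        chartVolume g c' (A ∩ (chartAt 𝔼 c).source ∩ (chartAt 𝔼 c').source) := by
      refine le_antisymm ?_ (measure_mono inter_subset_left)
      calc _ ≤ chartVolume g c' ((A ∩ (chartAt 𝔼 c).source ∩ (chartAt 𝔼 c').source) ∪
              (chartAt 𝔼 c').sourceᶜ) := measure_mono fun z hz => by
            by_cases h : z ∈ (chartAt 𝔼 c').source
            · exact Or.inl ⟨hz, h⟩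
            · exact Or.inr h
        _ ≤ _ := measure_union_le _ _
        _ = _ := by rw [chartVolume_compl_source, add_zero]
    rw [h1, chartVolume_eq_of_subset hg ((hA.inter (hS c)).inter (hS c'))
      (inter_subset_left.trans inter_subset_right) inter_subset_right]
    exact measure_mono (inter_subset_left.trans inter_subset_left)
  refine le_antisymm ?_ ?_
  · have h := Measure.restrict_mono (Subset.refl (chartAt 𝔼 c).source) hle
    refine h.trans ?_
    rw [Measure.restrict_add, Measure.restrict_restrict (hS c), inter_compl_self,
      Measure.restrict_empty, add_zero]
    exact Measure.restrict_le_self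
  · have h : (chartVolume g c).restrict (chartAt 𝔼 c).source = chartVolume g c := by
      rw [Measure.restrict_eq_self_of_ae_mem]
      exact chartVolume_compl_source g c
    rw [← h]
    exact Measure.restrict_mono Subset.rfl (le_iSup (fun c' => chartVolume g c') c)

lemma aemeasurable_vol_chart (hg : IsSmoothMetric g) (c : M) :
    AEMeasurable (fun y => ENNReal.ofReal (vol g c ((extChartAt (𝓡 2) c).symm y)))
      ((volume : Measure 𝔼).restrict (extChartAt (𝓡 2) c).target) := by
  refine AEMeasurable.ennreal_ofReal (ContinuousOn.aemeasurable ?_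
    (isOpen_extChartAt_target c).measurableSet)
  have h : ContinuousOn (vol g c) (chartAt 𝔼 c).source := fun x hx =>
    (hg.smoothNear_vol hx).continuousAt.continuousWithinAt
  exact h.comp (continuousOn_extChartAt_symm c) fun y hy => symm_mem_chart_source hy

/-- The integral of a function supported in a chart, in coordinates. -/
lemma integral_riemVolume_eq (hg : IsSmoothMetric g) {q : M → ℝ} (hq : Continuous q)
    (hqs : ∀ x ∉ (chartAt 𝔼 c).source, q x = 0) : ∫ x, q x ∂riemVolume g =
      ∫ y in (extChartAt (𝓡 2) c).target, vol g c ((extChartAt (𝓡 2) c).symm y) *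
        q ((extChartAt (𝓡 2) c).symm y) := by
  rw [← setIntegral_eq_integral_of_forall_compl_eq_zero hqs, riemVolume_restrict hg,
    chartVolume_eq_map,
    integral_map ((aemeasurable_extChartAt_symm c).mono_ac (withDensity_absolutelyContinuous _ _))
      hq.aestronglyMeasurable,
    integral_withDensity_eq_integral_toReal_smul₀ (aemeasurable_vol_chart hg c)
      (Eventually.of_forall fun _ => ENNReal.ofReal_lt_top)]
  refine integral_congr_ae (Eventually.of_forall fun y => ?_)
  simp only [smul_eq_mul]
  rw [ENNReal.toReal_ofReal (vol_nonneg _ _ _)]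

variable [CompactSpace M]

lemma exists_finset_chart_cover (M : Type*) [TopologicalSpace M] [ChartedSpace 𝔼 M]
    [CompactSpace M] : ∃ s : Finset M, ⋃ c : s, (chartAt 𝔼 (c : M)).source = univ := by
  obtain ⟨s, hs⟩ := isCompact_univ.elim_finite_subcover (fun c : M => (chartAt 𝔼 c).source)
    (fun c => (chartAt 𝔼 c).open_source) (fun x _ => mem_iUnion.2 ⟨x, mem_chart_source 𝔼 x⟩)
  refine ⟨s, eq_univ_of_univ_subset (hs.trans ?_)⟩
  intro x hx
  simp only [mem_iUnion] at hx ⊢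
  obtain ⟨c, hc, hxc⟩ := hx
  exact ⟨⟨c, hc⟩, hxc⟩

/-- `dV_{e^u g} = e^u dV_g` in dimension two. -/
lemma riemVolume_conformal (hg : IsSmoothMetric g) {u : M → ℝ}
    (hu : ContMDiff (𝓡 2) 𝓘(ℝ, ℝ) ∞ u) : riemVolume (conformal u g) =
      (riemVolume g).withDensity fun x => ENNReal.ofReal (Real.exp (u x)) := by
  obtain ⟨s, hs⟩ := exists_finset_chart_cover M
  rw [Measure.ext_iff_of_iUnion_eq_univ hs]
  rintro ⟨c, -⟩
  have hE : Measurable fun x => ENNReal.ofReal (Real.exp (u x)) :=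
    (Real.continuous_exp.comp hu.continuous).measurable.ennreal_ofReal
  rw [riemVolume_restrict (hg.conformal hu), restrict_withDensity
    (chartAt 𝔼 c).open_source.measurableSet, riemVolume_restrict hg]
  ext A hA
  rw [chartVolume_apply _ c hA, withDensity_apply _ hA, chartVolume_eq_map,
    Measure.restrict_map_of_aemeasurable ((aemeasurable_extChartAt_symm c).mono_ac
      (withDensity_absolutelyContinuous _ _)) hA,
    lintegral_map' hE.aemeasurable (((aemeasurable_extChartAt_symm c).mono_ac
      (withDensity_absolutelyContinuous _ _)).mono_measure Measure.restrict_le_self),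
    restrict_withDensity', Measure.restrict_restrict' (isOpen_extChartAt_target c).measurableSet,
    inter_comm]
  have hsub : (volume : Measure 𝔼).restrict ((extChartAt (𝓡 2) c).symm ⁻¹' A ∩
      (extChartAt (𝓡 2) c).target) ≤ volume.restrict (extChartAt (𝓡 2) c).target :=
    Measure.restrict_mono inter_subset_right le_rfl
  have hm : AEMeasurable (fun y => ENNReal.ofReal (Real.exp (u ((extChartAt (𝓡 2) c).symm y))))
      ((volume : Measure 𝔼).restrict ((extChartAt (𝓡 2) c).symm ⁻¹' A ∩
      (extChartAt (𝓡 2) c).target)) :=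
    (hE.comp_aemeasurable (aemeasurable_extChartAt_symm c)).mono_measure hsub
  have := lintegral_withDensity_eq_lintegral_mul₀
    ((aemeasurable_vol_chart hg c).mono_measure hsub) hm
  refine Eq.trans ?_ this.symm
  refine lintegral_congr fun y => ?_
  rw [Pi.mul_apply, ← ENNReal.ofReal_mul (vol_nonneg _ _ _), vol_conformal, mul_comm]

lemma integral_riemVolume_conformal (hg : IsSmoothMetric g) {u : M → ℝ}
    (hu : ContMDiff (𝓡 2) 𝓘(ℝ, ℝ) ∞ u) (q : M → ℝ) :
    ∫ x, q x ∂riemVolume (conformal u g) = ∫ x, Real.exp (u x) * q x ∂riemVolume g := by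
  have hE : Measurable fun x => ENNReal.ofReal (Real.exp (u x)) :=
    (Real.continuous_exp.comp hu.continuous).measurable.ennreal_ofReal
  rw [riemVolume_conformal hg hu, integral_withDensity_eq_integral_toReal_smul hE
    (Eventually.of_forall fun _ => ENNReal.ofReal_lt_top)]
  refine integral_congr_ae (Eventually.of_forall fun y => ?_)
  simp only [smul_eq_mul]
  rw [ENNReal.toReal_ofReal (Real.exp_pos _).le]

end Volume

section Green

variable {M : Type*} [TopologicalSpace M] [ChartedSpace (EuclideanSpace ℝ (Fin 2)) M]
  [IsManifold (𝓡 2) ∞ M] {c c' x : M} {g : TensorField₂ M}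

/-! ### Green's identity -/

lemma integral_fderiv_apply_eq_zero {Z : 𝔼 → ℝ} (hZ : ContDiff ℝ ∞ Z)
    (hc : HasCompactSupport Z) (e : 𝔼) : ∫ y, fderiv ℝ Z y e = 0 := by
  have hd : Continuous fun y => fderiv ℝ Z y e :=
    (hZ.continuous_fderiv (by simp)).clm_apply continuous_const
  have hdc : HasCompactSupport fun y => fderiv ℝ Z y e := hc.fderiv_apply ℝ e
  have h := integral_mul_fderiv_eq_neg_fderiv_mul_of_integrable (μ := (volume : Measure 𝔼))
    (f := fun _ => (1 : ℝ)) (g := Z) (v := e) (by simp)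
    (by simpa using hd.integrable_of_hasCompactSupport hdc)
    (by simpa using hZ.continuous.integrable_of_hasCompactSupport hc)
    (fun _ _ => differentiableAt_const _) (fun y _ => hZ.differentiable (by simp) y)
  simpa using h

variable [CompactSpace M]

/-- The integral of a partial derivative of a function supported in a chart vanishes: the function
extends by zero to a smooth compactly supported function on the plane. -/
lemma integrableOn_pd_and_integral_eq_zero [T2Space M] {Y : M → ℝ}
    (hY : ∀ x ∈ (chartAt 𝔼 c).source, SmoothNear Y x)
    (hYs : tsupport Y ⊆ (chartAt 𝔼 c).source) (i : Fin 2) :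
    IntegrableOn (fun y => pd c i Y ((extChartAt (𝓡 2) c).symm y)) (extChartAt (𝓡 2) c).target ∧
    ∫ y in (extChartAt (𝓡 2) c).target, pd c i Y ((extChartAt (𝓡 2) c).symm y) = 0 := by
  classical
  set T := (extChartAt (𝓡 2) c).target with hT
  have hTo : IsOpen T := isOpen_extChartAt_target c
  set Z : 𝔼 → ℝ := T.indicator fun y => Y ((extChartAt (𝓡 2) c).symm y) with hZdef
  set K : Set 𝔼 := extChartAt (𝓡 2) c '' tsupport Y with hK
  have hYs' : tsupport Y ⊆ (extChartAt (𝓡 2) c).source := by rwa [extChartAt_source]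
  have hKc : IsCompact K := (isClosed_tsupport Y).isCompact.image_of_continuousOn
    ((continuousOn_extChartAt c).mono hYs')
  have hZK : ∀ y ∉ K, Z y = 0 := by
    intro y hy
    by_cases hyT : y ∈ T
    · rw [hZdef, indicator_of_mem hyT]
      by_contra hne
      exact hy ⟨(extChartAt (𝓡 2) c).symm y, subset_tsupport _ hne,
        (extChartAt (𝓡 2) c).right_inv hyT⟩
    · rw [hZdef, indicator_of_notMem hyT]
  have hZ0 : ∀ y ∉ T, Z =ᶠ[𝓝 y] fun _ => 0 := by
    intro y hy
    have hyK : y ∉ K := fun ⟨x, hx, hxy⟩ => hy (hxy ▸ (extChartAt (𝓡 2) c).map_source (hYs' hx))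
    filter_upwards [hKc.isClosed.isOpen_compl.mem_nhds hyK] with z hz using hZK z hz
  have hZ1 : ∀ y ∈ T, Z =ᶠ[𝓝 y] fun y => Y ((extChartAt (𝓡 2) c).symm y) := by
    intro y hy
    filter_upwards [hTo.mem_nhds hy] with z hz
    rw [hZdef, indicator_of_mem hz]
  have hZs : ContDiff ℝ ∞ Z := by
    rw [contDiff_iff_contDiffAt]
    intro y
    by_cases hy : y ∈ T
    · refine ContDiffAt.congr_of_eventuallyEq ?_ (hZ1 y hy)
      have h1 : ContMDiffAt 𝓘(ℝ, 𝔼) (𝓡 2) ∞ (extChartAt (𝓡 2) c).symm y :=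
        (contMDiffOn_extChartAt_symm (I := 𝓡 2) (n := ∞) c).contMDiffAt (hTo.mem_nhds hy)
      exact ((hY _ (symm_mem_chart_source hy)).contMDiffAt.comp y h1).contDiffAt
    · exact contDiffAt_const.congr_of_eventuallyEq (hZ0 y hy)
  have hZc : HasCompactSupport Z := HasCompactSupport.intro hKc hZK
  have hfd : EqOn (fun y => pd c i Y ((extChartAt (𝓡 2) c).symm y))
      (fun y => fderiv ℝ Z y (EuclideanSpace.single i 1)) T := by
    intro y hy
    simp only [pd]
    rw [(hZ1 y hy).fderiv_eq, (extChartAt (𝓡 2) c).right_inv hy]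
  constructor
  · refine IntegrableOn.congr_fun (Integrable.integrableOn ?_) hfd.symm hTo.measurableSet
    exact ((hZs.continuous_fderiv (by simp)).clm_apply
      continuous_const).integrable_of_hasCompactSupport (hZc.fderiv_apply ℝ _)
  · rw [setIntegral_congr_fun hTo.measurableSet hfd,
      setIntegral_eq_integral_of_forall_compl_eq_zero, integral_fderiv_apply_eq_zero hZs hZc]
    intro y hy
    rw [(hZ0 y hy).fderiv_eq]; simp

lemma continuous_of_smoothNear {f : M → ℝ} (hf : ∀ x, SmoothNear f x) : Continuous f :=
  continuous_iff_continuousAt.2 fun x => (hf x).continuousAt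

lemma dInner_eq_zero_of_notMem_tsupport {ψ k : M → ℝ} (hx : x ∉ tsupport ψ) :
    dInner g x ψ k x = 0 := by
  have h : ψ =ᶠ[𝓝 x] fun _ => 0 := notMem_tsupport_iff_eventuallyEq.1 hx
  have hp : ∀ i, pd x i ψ x = 0 := fun i => by
    rw [pd_congr (mem_chart_source 𝔼 x) h, pd_const]
  simp [dInner, hp]

variable [MeasurableSpace M] [BorelSpace M]

/-- Green's identity for a function supported in one chart: times the volume density, the integrand
is the coordinate divergence of `ψ (det g)^{1/2} ∇k`. -/
lemma integral_green_of_tsupport_subset [T2Space M] (hg : IsSmoothMetric g) {ψ k : M → ℝ}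
    (hψ : ∀ x, SmoothNear ψ x) (hk : ∀ x, SmoothNear k x)
    (hψs : tsupport ψ ⊆ (chartAt 𝔼 c).source) :
    ∫ x, (ψ x * laplacian g k x + dInner g x ψ k x) ∂riemVolume g = 0 := by
  have hcont : Continuous fun x => ψ x * laplacian g k x + dInner g x ψ k x :=
    continuous_of_smoothNear fun x =>
      ((hψ x).mul (hg.smoothNear_laplacian (hk x))).add (hg.smoothNear_dInner_self (hψ x) (hk x))
  set W : Fin 2 → M → ℝ := fun i y => vol g c y * ∑ j, gInv g c i j y * pd c j k y with hW
  have hWs : ∀ i, ∀ x ∈ (chartAt 𝔼 c).source, SmoothNear (W i) x := fun i x hx =>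
    hg.smoothNear_sum_gInv_pd hx (hk x) i
  have hYs : ∀ i, ∀ x ∈ (chartAt 𝔼 c).source, SmoothNear (fun y => ψ y * W i y) x :=
    fun i x hx => (hψ x).mul (hWs i x hx)
  have hYsup : ∀ i, tsupport (fun y => ψ y * W i y) ⊆ tsupport ψ := fun i =>
    tsupport_mul_subset_left
  rw [integral_riemVolume_eq (c := c) hg hcont]
  · have key : ∀ y ∈ (extChartAt (𝓡 2) c).target,
        vol g c ((extChartAt (𝓡 2) c).symm y) *
          (ψ ((extChartAt (𝓡 2) c).symm y) * laplacian g k ((extChartAt (𝓡 2) c).symm y) +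
            dInner g ((extChartAt (𝓡 2) c).symm y) ψ k ((extChartAt (𝓡 2) c).symm y)) =
        pd c 0 (fun y => ψ y * W 0 y) ((extChartAt (𝓡 2) c).symm y) +
          pd c 1 (fun y => ψ y * W 1 y) ((extChartAt (𝓡 2) c).symm y) := by
      intro y hy
      have hx := symm_mem_chart_source hy
      set x := (extChartAt (𝓡 2) c).symm y
      have hv := (hg.vol_pos hx).ne'
      rw [hg.laplacian_eq hx (hk x), hg.dInner_eq_self hx (hψ x) (hk x),
        pd_mul (hψ x) (hWs 0 x hx) hx, pd_mul (hψ x) (hWs 1 x hx) hx]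
      simp only [lapIn, dInner, hW, Fin.sum_univ_two]
      field_simp
      ring
    have hint := fun i => integrableOn_pd_and_integral_eq_zero (hYs i) ((hYsup i).trans hψs) i
    rw [setIntegral_congr_fun (isOpen_extChartAt_target c).measurableSet key,
      integral_add (hint 0).1 (hint 1).1, (hint 0).2, (hint 1).2, add_zero]
  · intro x hx
    have h1 : x ∉ tsupport ψ := fun h => hx (hψs h)
    rw [dInner_eq_zero_of_notMem_tsupport h1, image_eq_zero_of_notMem_tsupport h1]
    ring

/-- A finite smooth partition of unity subordinate to the chart domains. -/
lemma exists_finite_partition [T2Space M] : ∃ (s : Finset M) (χ : s → M → ℝ),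
    (∀ a x, SmoothNear (χ a) x) ∧ (∀ a, tsupport (χ a) ⊆ (chartAt 𝔼 (a : M)).source) ∧
      ∀ x, ∑ a, χ a x = 1 := by
  obtain ⟨s, hs⟩ := exists_finset_chart_cover M
  obtain ⟨f, hf⟩ := SmoothPartitionOfUnity.exists_isSubordinate (𝓡 2) (isClosed_univ (X := M))
    (fun c : s => (chartAt 𝔼 (c : M)).source) (fun c => (chartAt 𝔼 (c : M)).open_source) hs.ge
  refine ⟨s, fun a => f a, fun a x => smoothNear_of_contMDiff (f a).contMDiff x, hf, fun x => ?_⟩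
  rw [← finsum_eq_sum_of_fintype]
  exact f.sum_eq_one (mem_univ x)

lemma integrable_of_continuous [IsFiniteMeasure (riemVolume g)] {q : M → ℝ}
    (hq : Continuous q) : Integrable q (riemVolume g) :=
  hq.integrable_of_hasCompactSupport (HasCompactSupport.of_compactSpace q)

/-- Green's identity on a closed surface. -/
theorem integral_mul_laplacian [T2Space M] (hg : IsSmoothMetric g)
    [IsFiniteMeasure (riemVolume g)] {h k : M → ℝ}
    (hh : ∀ x, SmoothNear h x) (hk : ∀ x, SmoothNear k x) :
    ∫ x, h x * laplacian g k x ∂riemVolume g = -∫ x, dInner g x h k x ∂riemVolume g := by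
  obtain ⟨s, χ, hχ, hχs, hχ1⟩ := exists_finite_partition (M := M)
  have hs : ∀ a x, SmoothNear (fun y => χ a y * h y) x := fun a x => (hχ a x).mul (hh x)
  have hL : Continuous fun x => h x * laplacian g k x := continuous_of_smoothNear fun x =>
    (hh x).mul (hg.smoothNear_laplacian (hk x))
  have hD : ∀ f : M → ℝ, (∀ x, SmoothNear f x) → Continuous fun x => dInner g x f k x :=
    fun f hf => continuous_of_smoothNear fun x => hg.smoothNear_dInner_self (hf x) (hk x)
  have hsum : ∀ x, h x * laplacian g k x + dInner g x h k x =
      ∑ a, (χ a x * h x * laplacian g k x + dInner g x (fun y => χ a y * h y) k x) := by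
    intro x
    have e : h = fun y => ∑ a, χ a y * h y := by
      funext y; rw [← Finset.sum_mul, hχ1, one_mul]
    have hp : ∀ i, pd x i h x = ∑ a, pd x i (fun y => χ a y * h y) x := by
      intro i
      conv_lhs => rw [e]
      exact pd_sum (fun a _ => hs a x) (mem_chart_source 𝔼 x) i
    rw [Finset.sum_add_distrib, ← Finset.sum_mul, ← Finset.sum_mul, hχ1, one_mul]
    simp only [dInner, hp, Fin.sum_univ_two, Finset.mul_sum, Finset.sum_mul,
      ← Finset.sum_add_distrib]
  have h0 : ∫ x, (h x * laplacian g k x + dInner g x h k x) ∂riemVolume g = 0 := by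
    simp only [hsum]
    rw [integral_finsetSum]
    · exact Finset.sum_eq_zero fun a _ =>
        integral_green_of_tsupport_subset (c := (a : M)) hg (hs a) hk
          ((tsupport_mul_subset_left).trans (hχs a))
    · intro a _
      exact integrable_of_continuous (continuous_of_smoothNear fun x =>
        ((hs a x).mul (hg.smoothNear_laplacian (hk x))).add
          (hg.smoothNear_dInner_self (hs a x) (hk x)))
  rw [integral_add (integrable_of_continuous hL) (integrable_of_continuous (hD h hh))] at h0
  linarith

lemma integral_laplacian [T2Space M] (hg : IsSmoothMetric g) [IsFiniteMeasure (riemVolume g)]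
    {k : M → ℝ} (hk : ∀ x, SmoothNear k x) : ∫ x, laplacian g k x ∂riemVolume g = 0 := by
  have h := integral_mul_laplacian hg (h := fun _ => 1) (fun x => smoothNear_const 1) hk
  have h1 : ∀ x, dInner g x (fun _ => 1) k x = 0 := fun x => by simp [dInner, pd_const]
  simpa [h1] using h

end Green

/-! ### Differentiation under the integral sign on a time interval -/

section Leibniz

/-- Differentiation under the integral sign over a compact space, with one-sided derivatives at the
endpoints of the interval. -/
lemma hasDerivWithinAt_integral_of_continuousOn {X : Type*} [TopologicalSpace X] [CompactSpace X]
    [MeasurableSpace X] [OpensMeasurableSpace X] {μ : Measure X} [IsFiniteMeasure μ] {J : Set ℝ}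
    (hJ : J.OrdConnected) {e e' : ℝ → X → ℝ}
    (hd : ∀ t ∈ J, ∀ x, HasDerivWithinAt (fun s => e s x) (e' t x) J t)
    (hc : ContinuousOn (fun p : ℝ × X => e' p.1 p.2) (J ×ˢ univ))
    (he : ∀ t ∈ J, Continuous (e t)) {t : ℝ} (ht : t ∈ J) :
    HasDerivWithinAt (fun s => ∫ x, e s x ∂μ) (∫ x, e' t x ∂μ) J t := by
  have hint : ∀ s ∈ J, Integrable (e s) μ := fun s hs =>
    (he s hs).integrable_of_hasCompactSupport (HasCompactSupport.of_compactSpace _)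
  have hct : Continuous (e' t) := by
    have : ContinuousOn (fun x : X => e' t x) univ :=
      hc.comp (f := fun x : X => (t, x)) (by fun_prop) fun x _ => ⟨ht, mem_univ x⟩
    exact continuousOn_univ.1 this
  obtain ⟨C, hC⟩ := (isCompact_univ (X := X)).exists_bound_of_continuousOn hct.continuousOn
  -- By compactness `e'` is bounded uniformly in `x` at times close to `t`; by the mean value
  -- inequality the difference quotients are then dominated.
  have hev : ∀ᶠ s in 𝓝 t, ∀ x ∈ (univ : Set X), s ∈ J → ‖e' s x‖ < C + 1 := by
    refine isCompact_univ.eventually_forall_of_forall_eventually fun x _ => ?_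
    have h1 := (hc (t, x) ⟨ht, mem_univ x⟩).norm
    have h2 : ‖e' t x‖ < C + 1 := by linarith [hC x (mem_univ x)]
    have h3 := h1.eventually (eventually_lt_nhds h2)
    rw [eventually_nhdsWithin_iff] at h3
    filter_upwards [h3] with p hp hpJ using hp ⟨hpJ, mem_univ _⟩
  obtain ⟨δ, hδ, hB⟩ := Metric.eventually_nhds_iff_ball.1 hev
  have hconv : Convex ℝ (J ∩ Metric.ball t δ) := hJ.convex.inter (convex_ball t δ)
  rw [hasDerivWithinAt_iff_tendsto_slope]
  have hmem : ∀ᶠ s in 𝓝[J \ {t}] t, s ∈ J ∧ s ∈ Metric.ball t δ ∧ s ≠ t := by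
    filter_upwards [self_mem_nhdsWithin,
      mem_nhdsWithin_of_mem_nhds (Metric.ball_mem_nhds t hδ)] with s hs hs'
      using ⟨hs.1, hs', hs.2⟩
  have hslope : (fun s => ∫ x, slope (fun s => e s x) t s ∂μ) =ᶠ[𝓝[J \ {t}] t]
      slope (fun s => ∫ x, e s x ∂μ) t := by
    filter_upwards [hmem] with s hs
    simp only [slope, vsub_eq_sub, smul_eq_mul]
    rw [integral_const_mul, integral_sub (hint s hs.1) (hint t ht)]
  refine Tendsto.congr' hslope ?_
  refine tendsto_integral_filter_of_dominated_convergence (fun _ => C + 1) ?_ ?_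
    (integrable_const _) ?_
  · filter_upwards [hmem] with s hs
    simp only [slope, vsub_eq_sub, smul_eq_mul]
    exact (((hint s hs.1).sub (hint t ht)).const_mul _).aestronglyMeasurable
  · filter_upwards [hmem] with s hs
    refine Eventually.of_forall fun x => ?_
    have h1 : ∀ r ∈ J ∩ Metric.ball t δ,
        HasDerivWithinAt (fun s => e s x) (e' r x) (J ∩ Metric.ball t δ) r :=
      fun r hr => (hd r hr.1 x).mono inter_subset_left
    have h2 := hconv.norm_image_sub_le_of_norm_hasDerivWithin_le h1
      (fun r hr => (hB r hr.2 x (mem_univ x) hr.1).le) ⟨ht, Metric.mem_ball_self hδ⟩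
      ⟨hs.1, hs.2.1⟩
    have h3 : 0 < ‖s - t‖ := norm_pos_iff.2 (sub_ne_zero.2 hs.2.2)
    rw [slope, norm_smul, norm_inv, vsub_eq_sub, inv_mul_le_iff₀ h3, mul_comm]
    exact h2
  · exact Eventually.of_forall fun x => hasDerivWithinAt_iff_tendsto_slope.1 (hd t ht x)

end Leibniz

section JointSmoothRules

variable {M : Type*} [TopologicalSpace M] [ChartedSpace (EuclideanSpace ℝ (Fin 2)) M]
  {J : Set ℝ} {V : Set M} {w w' : ℝ → M → ℝ}

lemma JointSmooth.congr (hw : JointSmooth J V w) (h : ∀ t ∈ J, ∀ x ∈ V, w' t x = w t x) :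
    JointSmooth J V w' := ContMDiffOn.congr hw fun p hp => h p.1 hp.1 p.2 hp.2

lemma JointSmooth.add (hw : JointSmooth J V w) (hw' : JointSmooth J V w') :
    JointSmooth J V (fun t x => w t x + w' t x) := ContMDiffOn.add hw hw'

lemma JointSmooth.sub (hw : JointSmooth J V w) (hw' : JointSmooth J V w') :
    JointSmooth J V (fun t x => w t x - w' t x) := ContMDiffOn.sub hw hw'

lemma JointSmooth.mul (hw : JointSmooth J V w) (hw' : JointSmooth J V w') :
    JointSmooth J V (fun t x => w t x * w' t x) := ContMDiffOn.mul hw hw'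

lemma JointSmooth.comp {φ : ℝ → ℝ} (hφ : ContDiff ℝ ∞ φ) (hw : JointSmooth J V w) :
    JointSmooth J V (fun t x => φ (w t x)) :=
  (contMDiff_iff_contDiff.2 hφ).comp_contMDiffOn hw

end JointSmoothRules

section Evolution

variable {ι M : Type*} [TopologicalSpace M] [ChartedSpace (EuclideanSpace ℝ (Fin 2)) M]
  [IsManifold (𝓡 2) ∞ M] {c x : M} {g F : TensorField₂ M} {L : U1Bundle ι M}
  {J : Set ℝ} {u : ℝ → M → ℝ} {A : ℝ → Connection L}

/-! ### The Laplacian of a square and the conformal change of two-forms -/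

lemma lapIn_mul_self (hg : IsSmoothMetric g) (hx : x ∈ (chartAt 𝔼 c).source) {f : M → ℝ}
    (hf : SmoothNear f x) (a : ℝ) : lapIn g c (fun y => a * (f y * f y)) x =
      a * (2 * f x * lapIn g c f x + 2 * dInner g c f f x) := by
  have hv := (hg.vol_pos hx).ne'
  set W : Fin 2 → M → ℝ := fun i y => vol g c y * ∑ j, gInv g c i j y * pd c j f y with hW
  have hWs : ∀ i, SmoothNear (W i) x := fun i => hg.smoothNear_sum_gInv_pd hx hf i
  have e : ∀ i, (fun y => vol g c y * ∑ j, gInv g c i j y *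
      pd c j (fun y => a * (f y * f y)) y) =ᶠ[𝓝 x] fun y => a * (2 * (f y * W i y)) := by
    intro i
    filter_upwards [chart_source_mem_nhds hx, hf.eventually] with y hy hfy
    simp only [pd_const_mul hy (hfy.mul hfy), pd_mul hfy hfy hy, hW, Fin.sum_univ_two]
    ring
  have h1 : ∀ i, pd c i (fun y => a * (2 * (f y * W i y))) x =
      a * (2 * (f x * pd c i (W i) x + W i x * pd c i f x)) := by
    intro i
    rw [pd_const_mul hx ((smoothNear_const 2).mul (hf.mul (hWs i))),
      pd_const_mul hx (hf.mul (hWs i)), pd_mul hf (hWs i) hx]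
  have h2 : lapIn g c f x = (vol g c x)⁻¹ * ∑ i, pd c i (W i) x := rfl
  have h3 : lapIn g c (fun y => a * (f y * f y)) x = (vol g c x)⁻¹ *
      ∑ i, a * (2 * (f x * pd c i (W i) x + W i x * pd c i f x)) := by
    unfold lapIn
    congr 1
    exact Finset.sum_congr rfl fun i _ => by rw [pd_congr hx (e i), h1]
  have h4 : ∀ i, W i x = vol g c x * ∑ j, gInv g c i j x * pd c j f x := fun i => rfl
  rw [h2, h3]
  simp only [dInner, Fin.sum_univ_two, h4]
  field_simp
  ring

lemma density_conformal (u : M → ℝ) (g F : TensorField₂ M) (c : M) :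
    density (conformal u g) F c = fun y => Real.exp (-u y) * density g F c y := by
  funext y
  rw [density, vol_conformal, density, Real.exp_neg]
  field_simp

/-- The function `e^{-2u} |F|² = 2 f²`, where `F = f dV` for the volume of `e^u g`. -/
def confSq (g F : TensorField₂ M) (u : M → ℝ) (x : M) : ℝ :=
  Real.exp (-2 * u x) * normSq g F x

lemma IsTwoForm.confSq_eq (hF : IsTwoForm F) (hg : IsSmoothMetric g) (u : M → ℝ)
    (hx : x ∈ (chartAt 𝔼 c).source) : confSq g F u x =
      2 * (density (conformal u g) F c x * density (conformal u g) F c x) := by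
  rw [confSq, hF.normSq_eq hg hx, density_conformal,
    show -2 * u x = -u x + -u x by ring, Real.exp_add]
  ring

lemma IsTwoForm.smoothNear_density_conformal (hF : IsTwoForm F) (hg : IsSmoothMetric g)
    {u : M → ℝ} (hu : ContMDiff (𝓡 2) 𝓘(ℝ, ℝ) ∞ u) (hx : x ∈ (chartAt 𝔼 c).source) :
    SmoothNear (density (conformal u g) F c) x :=
  (hg.conformal hu).smoothNear_density hx (hF.2.1 c x hx)

lemma IsTwoForm.smoothNear_confSq (hF : IsTwoForm F) (hg : IsSmoothMetric g)
    {u : M → ℝ} (hu : ContMDiff (𝓡 2) 𝓘(ℝ, ℝ) ∞ u) (x : M) : SmoothNear (confSq g F u) x := by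
  have hx := mem_chart_source 𝔼 x
  have hs := hF.smoothNear_density_conformal hg hu hx
  refine ((smoothNear_const 2).mul (hs.mul hs)).congr ?_
  filter_upwards [chart_source_mem_nhds hx] with y hy using hF.confSq_eq hg u hy

/-- `e^u |∇^g F|²_g` for `g = e^u g₀` in terms of `g₀`. -/
lemma IsTwoForm.exp_mul_nablaNormSq (hF : IsTwoForm F) (hg : IsSmoothMetric g)
    {u : M → ℝ} (hu : ContMDiff (𝓡 2) 𝓘(ℝ, ℝ) ∞ u) (x : M) :
    Real.exp (u x) * nablaNormSq (conformal u g) F x =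
      2 * dInner g x (density (conformal u g) F x) (density (conformal u g) F x) x := by
  have hx := mem_chart_source 𝔼 x
  rw [nablaNormSq_eq (hg.conformal hu) hF.1 (hF.2.1 x x hx), ← dInner_conformal hg hu hx]
  ring

/-- `Δ (e^{-2u} |F|²) = 4 f Δf + 4 |df|²`, where `F = f dV` for the volume of `e^u g`. -/
lemma IsTwoForm.laplacian_confSq (hF : IsTwoForm F) (hg : IsSmoothMetric g)
    {u : M → ℝ} (hu : ContMDiff (𝓡 2) 𝓘(ℝ, ℝ) ∞ u) (x : M) :
    laplacian g (confSq g F u) x =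
      4 * density (conformal u g) F x x * lapIn g x (density (conformal u g) F x) x +
        2 * (Real.exp (u x) * nablaNormSq (conformal u g) F x) := by
  have hx := mem_chart_source 𝔼 x
  have hs := hF.smoothNear_density_conformal hg hu hx
  have e : ∀ᶠ y in 𝓝 x, confSq g F u y =
      2 * (density (conformal u g) F x y * density (conformal u g) F x y) := by
    filter_upwards [chart_source_mem_nhds hx] with y hy using hF.confSq_eq hg u hy
  have h1 : laplacian g (confSq g F u) x = lapIn g x (fun y =>
      2 * (density (conformal u g) F x y * density (conformal u g) F x y)) x := by
    rw [laplacian_eq_lapIn]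
    unfold lapIn
    congr 1
    refine Finset.sum_congr rfl fun i _ => pd_congr hx ?_ i
    filter_upwards [e.eventually_nhds, chart_source_mem_nhds hx] with y hy hyx
    simp only [pd_congr hyx hy]
  rw [h1, lapIn_mul_self hg hx hs, hF.exp_mul_nablaNormSq hg hu]
  ring

/-! ### Evolution of the energy density -/

section Curvature

variable (hA : SmoothFamily J A) (hJ : UniqueDiffOn ℝ J)
include hA hJ

lemma jointSmooth_comp_curvature {i : ι} (c : M) :
    JointSmooth J (L.baseSet i ∩ (chartAt 𝔼 c).source)
      (fun t y => comp (A t).curvature c 0 1 y) := by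
  have ho := (L.isOpen_baseSet i).inter (chartAt 𝔼 c).open_source
  have ha : ∀ k, JointSmooth J (L.baseSet i ∩ (chartAt 𝔼 c).source)
      (fun t y => (A t).form i y (coordFrame c k y)) := fun k => hA i c k
  exact (((ha 1).pd hJ ho inter_subset_right 0).sub
    ((ha 0).pd hJ ho inter_subset_right 1)).congr
    fun t _ y hy => (A t).comp_curvature hy.1 hy.2

lemma jointSmooth_normSq (hg : IsSmoothMetric g) :
    JointSmooth J univ (fun t y => normSq g (A t).curvature y) := by
  refine jointSmooth_of_locally fun x _ =>
    ⟨L.baseSet (L.indexAt x) ∩ (chartAt 𝔼 x).source,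
      (L.isOpen_baseSet _).inter (chartAt 𝔼 x).open_source,
      ⟨L.mem_baseSet_at x, mem_chart_source 𝔼 x⟩, ?_⟩
  rw [univ_inter]
  have hF := jointSmooth_comp_curvature hA hJ (i := L.indexAt x) x
  have hv : JointSmooth J (L.baseSet (L.indexAt x) ∩ (chartAt 𝔼 x).source)
      (fun _ y => 2 * ((vol g x y)⁻¹ * (vol g x y)⁻¹)) :=
    jointSmooth_of_static (contMDiffOn_of_smoothNear fun y hy => by
      have h := (hg.smoothNear_vol hy.2).inv (hg.vol_pos hy.2).ne'
      exact (smoothNear_const 2).mul (h.mul h))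
  refine (hv.mul (hF.mul hF)).congr fun t _ y hy => ?_
  rw [(A t).isTwoForm_curvature.normSq_eq hg hy.2, density]
  ring

/-- `∂ₜ F = Δf dV₀`, where `F = f dV_{g(t)}`, along the flow `∂ₜ A = -d^*_{g(t)} F`. -/
lemma hasDerivWithinAt_comp_curvature (hJ' : J ⊆ closure (interior J)) (hg : IsSmoothMetric g)
    {t : ℝ} (ht : t ∈ J) (hu : ContMDiff (𝓡 2) 𝓘(ℝ, ℝ) ∞ (u t)) (hflow : ConnectionFlow g J u A)
    (x : M) :
    HasDerivWithinAt (fun s => comp (A s).curvature x 0 1 x)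
      (vol g x x * lapIn g x (density (conformal (u t) g) (A t).curvature x) x) J t := by
  have hx := mem_chart_source 𝔼 x
  have hi := L.mem_baseSet_at x
  set i := L.indexAt x
  have ho := (L.isOpen_baseSet i).inter (chartAt 𝔼 x).open_source
  have ha : ∀ k, JointSmooth J (L.baseSet i ∩ (chartAt 𝔼 x).source)
      (fun t y => (A t).form i y (coordFrame x k y)) := fun k => hA i x k
  have hd := ((ha 1).hasDerivWithinAt_pd hJ hJ' ho hx 0 ht ⟨hi, hx⟩).sub
    ((ha 0).hasDerivWithinAt_pd hJ hJ' ho hx 1 ht ⟨hi, hx⟩)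
  have e : ∀ k, (fun y => derivWithin (fun s => (A s).form i y (coordFrame x k y)) J t) =ᶠ[𝓝 x]
      fun y => starForm g x (density (conformal (u t) g) (A t).curvature x) y
        (coordFrame x k y) := by
    intro k
    filter_upwards [ho.mem_nhds ⟨hi, hx⟩] with y hy
    rw [(hflow t ht i y hy.1 (coordFrame x k y)).derivWithin (hJ t ht),
      (A t).isTwoForm_curvature.neg_codiff (hg.conformal hu) hy.2,
      starForm_conformal hg hu hy.2]
  rw [← hg.curl_starForm hx, curl, ← pd_congr hx (e 1), ← pd_congr hx (e 0)]
  exact hd.congr (fun s _ => (A s).comp_curvature hi hx) ((A t).comp_curvature hi hx)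

/-- The evolution of `e^{-u} |F|²`: the terms are `-uₜ e^{-u} |F|²`, a divergence and the
dissipation. -/
lemma hasDerivWithinAt_exp_mul_normSq (hJ' : J ⊆ closure (interior J)) (hg : IsSmoothMetric g)
    {t : ℝ} (ht : t ∈ J) (hu : ContMDiff (𝓡 2) 𝓘(ℝ, ℝ) ∞ (u t)) (hflow : ConnectionFlow g J u A)
    {x : M} {d : ℝ} (hd : HasDerivWithinAt (fun s => u s x) d J t) :
    HasDerivWithinAt (fun s => Real.exp (-u s x) * normSq g (A s).curvature x)
      (-(d * (Real.exp (-u t x) * normSq g (A t).curvature x)) +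
        laplacian g (confSq g (A t).curvature (u t)) x -
        2 * (Real.exp (u t x) * nablaNormSq (conformal (u t) g) (A t).curvature x)) J t := by
  have hx := mem_chart_source 𝔼 x
  have hv := (hg.vol_pos hx).ne'
  have h1 := hasDerivWithinAt_comp_curvature hA hJ hJ' hg ht hu hflow x
  have hn : ∀ s, normSq g (A s).curvature x =
      2 * (comp (A s).curvature x 0 1 x * comp (A s).curvature x 0 1 x) / vol g x x ^ 2 := by
    intro s
    rw [(A s).isTwoForm_curvature.normSq_eq hg hx, density]; field_simp
  have h2 := hd.neg.exp.mul (((h1.mul h1).const_mul 2).div_const (vol g x x ^ 2))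
  simp only [hn]
  refine h2.congr_deriv ?_
  rw [(A t).isTwoForm_curvature.laplacian_confSq hg hu]
  simp only [Pi.neg_apply, Pi.mul_apply]
  have h3 : density (conformal (u t) g) (A t).curvature x x =
      Real.exp (-u t x) * comp (A t).curvature x 0 1 x / vol g x x := by
    rw [density_conformal]; simp only [density]; ring
  rw [h3]
  field_simp
  ring

end Curvature

lemma jointSmooth_dNormSq (hg : IsSmoothMetric g) (hJ : UniqueDiffOn ℝ J)
    (hu : JointSmooth J univ u) : JointSmooth J univ (fun t y => dNormSq g (u t) y) := by
  refine jointSmooth_of_locally fun x _ => ⟨(chartAt 𝔼 x).source, (chartAt 𝔼 x).open_source,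
      mem_chart_source 𝔼 x, ?_⟩
  rw [univ_inter]
  have hp := fun i => (hu.mono (subset_univ (chartAt 𝔼 x).source)).pd hJ
    (chartAt 𝔼 x).open_source Subset.rfl i
  have hG : ∀ i j, JointSmooth J (chartAt 𝔼 x).source (fun _ y => gInv g x i j y) := fun i j =>
    jointSmooth_of_static (contMDiffOn_of_smoothNear fun y hy => hg.smoothNear_gInv hy i j)
  have ht := fun i j => ((hG i j).mul (hp i)).mul (hp j)
  refine (((ht 0 0).add (ht 0 1)).add ((ht 1 0).add (ht 1 1))).congr fun t htJ y hy => ?_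
  have hs := hu.smoothNear htJ isOpen_univ (mem_univ y)
  rw [dNormSq_eq_dInner, hg.dInner_eq_self hy hs hs]
  simp only [dInner, Fin.sum_univ_two]

lemma hasDerivWithinAt_dNormSq (hg : IsSmoothMetric g) (hJ : UniqueDiffOn ℝ J)
    (hJ' : J ⊆ closure (interior J)) (hu : JointSmooth J univ u) {t : ℝ} (ht : t ∈ J) (x : M) :
    HasDerivWithinAt (fun s => dNormSq g (u s) x)
      (2 * dInner g x (fun y => derivWithin (fun s => u s y) J t) (u t) x) J t := by
  have hx := mem_chart_source 𝔼 x
  have hp := fun i => hu.hasDerivWithinAt_pd hJ hJ' isOpen_univ hx i ht (mem_univ x)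
  simp only [dNormSq_eq_dInner, hg.dInner_eq hx]
  have h := (((((hp 0).const_mul (comp g x 1 1 x)).mul (hp 0)).sub
    ((((hp 0).mul (hp 1)).add ((hp 1).mul (hp 0))).const_mul (comp g x 0 1 x))).add
    (((hp 1).const_mul (comp g x 0 0 x)).mul (hp 1))).div_const (vol g x x ^ 2)
  refine h.congr_deriv ?_
  ring

end Evolution

section Energy

variable {ι M : Type*} [TopologicalSpace M] [ChartedSpace (EuclideanSpace ℝ (Fin 2)) M]
  [IsManifold (𝓡 2) ∞ M] [T2Space M] [CompactSpace M] [MeasurableSpace M] [BorelSpace M]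
  {g : TensorField₂ M} {L : U1Bundle ι M}
  {J : Set ℝ} {u : ℝ → M → ℝ} {A : ℝ → Connection L} {R₀ : ℝ}

/-! ### The derivative of the energy -/

lemma JointSmooth.continuous {w : ℝ → M → ℝ} (hw : JointSmooth J univ w) {t : ℝ} (ht : t ∈ J) :
    Continuous (w t) :=
  continuous_of_smoothNear fun x => hw.smoothNear ht isOpen_univ (mem_univ x)

lemma JointSmooth.contMDiff {w : ℝ → M → ℝ} (hw : JointSmooth J univ w) {t : ℝ} (ht : t ∈ J) :
    ContMDiff (𝓡 2) 𝓘(ℝ, ℝ) ∞ (w t) := contMDiffOn_univ.1 (hw.contMDiffOn ht)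

lemma JointSmooth.hasDerivWithinAt_integral {μ : Measure M} [IsFiniteMeasure μ]
    (hJc : J.OrdConnected) (hJ : UniqueDiffOn ℝ J) {w : ℝ → M → ℝ} (hw : JointSmooth J univ w)
    {t : ℝ} (ht : t ∈ J) :
    HasDerivWithinAt (fun s => ∫ x, w s x ∂μ)
      (∫ x, _root_.derivWithin (fun s => w s x) J t ∂μ) J t :=
  hasDerivWithinAt_integral_of_continuousOn hJc
    (fun _ hs x => hw.hasDerivWithinAt hs (mem_univ x))
    (hw.derivWithin hJ isOpen_univ).continuousOn (fun _ hs => hw.continuous hs) ht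

/-- The first variation of the energy along `∂ₜ A = -d^*F`, for an arbitrary variation of `u`. -/
theorem hasDerivWithinAt_energy (hg : IsSmoothMetric g) [IsFiniteMeasure (riemVolume g)]
    (hJc : J.OrdConnected) (hJ : UniqueDiffOn ℝ J) (hJ' : J ⊆ closure (interior J))
    (hu : JointSmooth J univ u) (hA : SmoothFamily J A) (hflow : ConnectionFlow g J u A)
    (R₀ : ℝ) {t : ℝ} (ht : t ∈ J) :
    HasDerivWithinAt (fun s => energy g R₀ (u s) (A s))
      (-2 * (∫ x, derivWithin (fun s => u s x) J t * (laplacian g (u t) x - R₀ +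
          (1 / 2) * (Real.exp (-u t x) * normSq g (A t).curvature x)) ∂riemVolume g) -
        2 * ∫ x, nablaNormSq (conformal (u t) g) (A t).curvature x
          ∂riemVolume (conformal (u t) g)) J t := by
  have hut : ContMDiff (𝓡 2) 𝓘(ℝ, ℝ) ∞ (u t) := hu.contMDiff ht
  have huN : ∀ x, SmoothNear (u t) x := smoothNear_of_contMDiff hut
  set v : M → ℝ := fun x => derivWithin (fun s => u s x) J t with hv
  have hvN : ∀ x, SmoothNear v x := fun x =>
    (hu.derivWithin hJ isOpen_univ).smoothNear ht isOpen_univ (mem_univ x)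
  have hD := jointSmooth_dNormSq hg hJ hu
  have hN := jointSmooth_normSq hA hJ hg
  have hexp : JointSmooth J univ (fun t x => Real.exp (-u t x)) :=
    hu.comp (φ := fun r => Real.exp (-r)) (by fun_prop)
  have hEN := hexp.mul hN
  have hR : JointSmooth J univ (fun t x => 2 * R₀ * u t x) :=
    hu.comp (φ := fun r => 2 * R₀ * r) (by fun_prop)
  have he := (hD.add hEN).add hR
  have henergy : ∀ s ∈ J, energy g R₀ (u s) (A s) = ∫ x, (dNormSq g (u s) x +
      Real.exp (-u s x) * normSq g (A s).curvature x + 2 * R₀ * u s x) ∂riemVolume g := by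
    intro s hs
    rw [energy, integral_add (integrable_of_continuous ((hD.add hEN).continuous hs))
      (integrable_of_continuous (hR.continuous hs)), integral_const_mul]
  set F := (A t).curvature with hF
  set Q := confSq g F (u t) with hQ
  set P : M → ℝ := fun x => Real.exp (u t x) * nablaNormSq (conformal (u t) g) F x with hP
  have hQN : ∀ x, SmoothNear Q x := (A t).isTwoForm_curvature.smoothNear_confSq hg hut
  have hder : ∀ x, derivWithin (fun s => dNormSq g (u s) x +
      Real.exp (-u s x) * normSq g (A s).curvature x + 2 * R₀ * u s x) J t =
      2 * dInner g x v (u t) x + (-(v x * (Real.exp (-u t x) * normSq g F x)) +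
        laplacian g Q x - 2 * P x) + 2 * R₀ * v x := by
    intro x
    have h0 := hu.hasDerivWithinAt ht (mem_univ x)
    exact (((hasDerivWithinAt_dNormSq hg hJ hJ' hu ht x).add
      (hasDerivWithinAt_exp_mul_normSq hA hJ hJ' hg ht hut hflow h0)).add
      (h0.const_mul (2 * R₀))).derivWithin (hJ t ht)
  have hmain := (he.hasDerivWithinAt_integral (μ := riemVolume g) hJc hJ ht).congr henergy
    (henergy t ht)
  refine hmain.congr_deriv ?_
  simp only [hder]
  have cv : Continuous v := continuous_of_smoothNear hvN
  have cN : Continuous fun x => Real.exp (-u t x) * normSq g F x := hEN.continuous ht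
  have cD : Continuous fun x => dInner g x v (u t) x := continuous_of_smoothNear fun x =>
    hg.smoothNear_dInner_self (hvN x) (huN x)
  have cQ : Continuous (laplacian g Q) := continuous_of_smoothNear fun x =>
    hg.smoothNear_laplacian (hQN x)
  have cL : Continuous (laplacian g (u t)) := continuous_of_smoothNear fun x =>
    hg.smoothNear_laplacian (huN x)
  -- `P` is the only term of the time derivative of the integrand whose continuity is not yet known.
  have cP : Continuous P := by
    have hsum := (he.derivWithin hJ isOpen_univ).continuous ht
    simp only [hder] at hsum
    have : P = fun x => (1 / 2) * (2 * dInner g x v (u t) x +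
        (-(v x * (Real.exp (-u t x) * normSq g F x)) + laplacian g Q x) + 2 * R₀ * v x -
        (2 * dInner g x v (u t) x + (-(v x * (Real.exp (-u t x) * normSq g F x)) +
        laplacian g Q x - 2 * P x) + 2 * R₀ * v x)) := by
      funext x; ring
    rw [this]
    exact continuous_const.mul (((((continuous_const.mul cD).add
      (((cv.mul cN).neg).add cQ)).add (continuous_const.mul cv))).sub hsum)
  have i1 : Integrable (fun x => dInner g x v (u t) x) (riemVolume g) := integrable_of_continuous cD
  have i2 : Integrable (fun x => v x * (Real.exp (-u t x) * normSq g F x)) (riemVolume g) :=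
    integrable_of_continuous (cv.mul cN)
  have i3 : Integrable (laplacian g Q) (riemVolume g) := integrable_of_continuous cQ
  have i4 : Integrable P (riemVolume g) := integrable_of_continuous cP
  have i5 : Integrable v (riemVolume g) := integrable_of_continuous cv
  have i6 : Integrable (fun x => v x * laplacian g (u t) x) (riemVolume g) :=
    integrable_of_continuous (cv.mul cL)
  have hgreen := integral_mul_laplacian hg hvN huN
  have hzero := integral_laplacian hg hQN
  have e1 : ∫ x, (2 * dInner g x v (u t) x + (-(v x * (Real.exp (-u t x) * normSq g F x)) +
        laplacian g Q x - 2 * P x) + 2 * R₀ * v x) ∂riemVolume g =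
      2 * (∫ x, dInner g x v (u t) x ∂riemVolume g) +
        (-(∫ x, v x * (Real.exp (-u t x) * normSq g F x) ∂riemVolume g) +
          (∫ x, laplacian g Q x ∂riemVolume g) - 2 * ∫ x, P x ∂riemVolume g) +
        2 * R₀ * ∫ x, v x ∂riemVolume g := by
    have i2' : Integrable (fun x => -(v x * (Real.exp (-u t x) * normSq g F x)))
      (riemVolume g) := i2.neg
    have j1 : Integrable (fun x => -(v x * (Real.exp (-u t x) * normSq g F x)) +
      laplacian g Q x) (riemVolume g) := i2'.add i3
    have j2 : Integrable (fun x => -(v x * (Real.exp (-u t x) * normSq g F x)) +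
      laplacian g Q x - 2 * P x) (riemVolume g) := j1.sub (i4.const_mul 2)
    have j3 : Integrable (fun x => 2 * dInner g x v (u t) x +
      (-(v x * (Real.exp (-u t x) * normSq g F x)) + laplacian g Q x - 2 * P x))
      (riemVolume g) := (i1.const_mul 2).add j2
    rw [integral_add j3 (i5.const_mul _), integral_add (i1.const_mul 2) j2,
      integral_sub j1 (i4.const_mul 2), integral_add i2' i3, integral_neg,
      integral_const_mul, integral_const_mul, integral_const_mul]
  have e2 : ∫ x, v x * (laplacian g (u t) x - R₀ +
      (1 / 2) * (Real.exp (-u t x) * normSq g F x)) ∂riemVolume g =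
      (∫ x, v x * laplacian g (u t) x ∂riemVolume g) - R₀ * (∫ x, v x ∂riemVolume g) +
        (1 / 2) * ∫ x, v x * (Real.exp (-u t x) * normSq g F x) ∂riemVolume g := by
    have j : Integrable (fun x => v x * laplacian g (u t) x - R₀ * v x) (riemVolume g) :=
      i6.sub (i5.const_mul _)
    rw [← integral_const_mul, ← integral_const_mul, ← integral_sub i6 (i5.const_mul _),
      ← integral_add j (i2.const_mul _)]
    exact integral_congr_ae (Eventually.of_forall fun x => by simp only; ring)
  rw [e1, e2, integral_riemVolume_conformal hg hut, hgreen, hzero]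
  ring

/-- The equation `V' = R₀ (V - 1)`, `V 0 = 1`, satisfied by the volume `V = ∫ e^u` along the
volume-normalized flow, has only the constant solution. -/
lemma eq_one_of_hasDerivWithinAt (hJc : J.OrdConnected) {V : ℝ → ℝ}
    (h0 : (0 : ℝ) ∈ J) (hV0 : V 0 = 1)
    (hV : ∀ t ∈ J, HasDerivWithinAt V (R₀ * (V t - 1)) J t) {t : ℝ} (ht : t ∈ J) : V t = 1 := by
  have hd : ∀ s ∈ J, HasDerivWithinAt (fun s => (V s - 1) * Real.exp (-R₀ * s)) 0 J s := by
    intro s hs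
    have h1 : HasDerivWithinAt (fun s => Real.exp (-R₀ * s)) (Real.exp (-R₀ * s) * (-R₀ * 1)) J s :=
      (((hasDerivAt_id s).const_mul (-R₀)).exp).hasDerivWithinAt
    refine (((hV s hs).sub_const 1).mul h1).congr_deriv ?_
    ring
  have h2 := hJc.convex.norm_image_sub_le_of_norm_hasDerivWithin_le hd
    (C := 0) (fun _ _ => by simp) h0 ht
  simp only [hV0, sub_self, zero_mul, sub_zero, norm_le_zero_iff, mul_eq_zero,
    (Real.exp_pos _).ne', or_false] at h2
  linarith

/-- Along the volume-normalized flow the volume of `e^u g₀` is stationary. -/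
lemma integral_exp_mul_derivWithin_eq_zero (hg : IsSmoothMetric g)
    [IsProbabilityMeasure (riemVolume g)]
    (hJc : J.OrdConnected) (hJ : UniqueDiffOn ℝ J) (h0 : (0 : ℝ) ∈ J)
    (hu : JointSmooth J univ u) (hA : SmoothFamily J A)
    (hflow : IsVolumeNormalizedRYMFlow g R₀ J u A)
    (hvol : R₀ ≠ 0 → (∫ x, Real.exp (u 0 x) ∂riemVolume g) = 1) {t : ℝ} (ht : t ∈ J) :
    ∫ x, Real.exp (u t x) * derivWithin (fun s => u s x) J t ∂riemVolume g = 0 := by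
  have hexp : JointSmooth J univ (fun t x => Real.exp (u t x)) := hu.comp Real.contDiff_exp
  have hEN : JointSmooth J univ (fun t x => Real.exp (-u t x) * normSq g (A t).curvature x) :=
    (hu.comp (φ := fun r => Real.exp (-r)) (by fun_prop)).mul (jointSmooth_normSq hA hJ hg)
  have key : ∀ s ∈ J, ∫ x, Real.exp (u s x) * derivWithin (fun s => u s x) J s ∂riemVolume g =
      R₀ * ((∫ x, Real.exp (u s x) ∂riemVolume g) - 1) := by
    intro s hs
    have huN : ∀ x, SmoothNear (u s) x := smoothNear_of_contMDiff (hu.contMDiff hs)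
    have iL : Integrable (laplacian g (u s)) (riemVolume g) :=
      integrable_of_continuous (continuous_of_smoothNear fun x => hg.smoothNear_laplacian (huN x))
    have iE : Integrable (fun x => Real.exp (u s x)) (riemVolume g) :=
      integrable_of_continuous (hexp.continuous hs)
    have iN : Integrable (fun x => Real.exp (-u s x) * normSq g (A s).curvature x)
      (riemVolume g) := integrable_of_continuous (hEN.continuous hs)
    have hE0 : (∫ x, Real.exp (u s x) ∂riemVolume g) ≠ 0 := (integral_exp_pos iE).ne'
    set E := ∫ x, Real.exp (u s x) ∂riemVolume g with hE
    set N := ∫ x, Real.exp (-u s x) * normSq g (A s).curvature x ∂riemVolume g with hN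
    have e : ∀ x, Real.exp (u s x) * derivWithin (fun s => u s x) J s =
        laplacian g (u s) x + (R₀ - N / E / 2) * Real.exp (u s x) - R₀ +
          (1 / 2) * (Real.exp (-u s x) * normSq g (A s).curvature x) := by
      intro x
      rw [(hflow.1 s hs x).derivWithin (hJ s hs)]
      have h1 : Real.exp (u s x) * Real.exp (-u s x) = 1 := by
        rw [← Real.exp_add]; simp
      have h2 : Real.exp (-2 * u s x) = Real.exp (-u s x) * Real.exp (-u s x) := by
        rw [← Real.exp_add]; congr 1; ring
      rw [h2]
      linear_combination (laplacian g (u s) x - R₀ +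
        (1 / 2) * (Real.exp (-u s x) * normSq g (A s).curvature x)) * h1
    simp only [e]
    have j1 : Integrable (fun x => laplacian g (u s) x + (R₀ - N / E / 2) * Real.exp (u s x))
      (riemVolume g) := iL.add (iE.const_mul _)
    have j2 : Integrable (fun x => laplacian g (u s) x + (R₀ - N / E / 2) * Real.exp (u s x) - R₀)
      (riemVolume g) := j1.sub (integrable_const _)
    rw [integral_add j2 (iN.const_mul _), integral_sub j1 (integrable_const _),
      integral_add iL (iE.const_mul _), integral_laplacian hg huN, integral_const_mul,
      integral_const_mul, integral_const, probReal_univ, smul_eq_mul, ← hE, ← hN]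
    field_simp
    ring
  by_cases hR : R₀ = 0
  · rw [key t ht, hR, zero_mul]
  · rw [key t ht, eq_one_of_hasDerivWithinAt (R₀ := R₀)
      (V := fun s => ∫ x, Real.exp (u s x) ∂riemVolume g) hJc h0 (hvol hR) ?_ ht,
      sub_self, mul_zero]
    intro s hs
    rw [← key s hs]
    refine (hexp.hasDerivWithinAt_integral hJc hJ hs).congr_deriv ?_
    refine integral_congr_ae (Eventually.of_forall fun x => ?_)
    exact (hu.hasDerivWithinAt hs (mem_univ x)).exp.derivWithin (hJ s hs)

lemma IsTwoForm.nablaNormSq_nonneg {F : TensorField₂ M} (hF : IsTwoForm F)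
    (hg : IsSmoothMetric g) (x : M) : 0 ≤ nablaNormSq g F x := by
  rw [nablaNormSq_eq hg hF.1 (hF.2.1 x x (mem_chart_source 𝔼 x))]
  exact mul_nonneg zero_le_two (hg.dInner_self_nonneg (mem_chart_source 𝔼 x) _)

/-- The energy identity for both flows. -/
theorem hasDerivWithinAt_energy_of_flow (hg : IsSmoothMetric g)
    [IsProbabilityMeasure (riemVolume g)]
    (hJc : J.OrdConnected) (hJ : UniqueDiffOn ℝ J) (hJ' : J ⊆ closure (interior J))
    (h0 : (0 : ℝ) ∈ J) (hu : JointSmooth J univ u) (hA : SmoothFamily J A)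
    (hflow : IsConformalRYMFlow g R₀ J u A ∨ (IsVolumeNormalizedRYMFlow g R₀ J u A ∧
      (R₀ ≠ 0 → (∫ x, Real.exp (u 0 x) ∂riemVolume g) = 1))) {t : ℝ} (ht : t ∈ J) :
    HasDerivWithinAt (fun s => energy g R₀ (u s) (A s))
      (-2 * (∫ x, Real.exp (u t x) * (derivWithin (fun s => u s x) J t) ^ 2 ∂riemVolume g) -
        2 * ∫ x, nablaNormSq (conformal (u t) g) (A t).curvature x
          ∂riemVolume (conformal (u t) g)) J t := by
  have hconn : ConnectionFlow g J u A := by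
    rcases hflow with h | h
    · exact h.2
    · exact h.1.2
  refine (hasDerivWithinAt_energy hg hJc hJ hJ' hu hA hconn R₀ ht).congr_deriv ?_
  congr 2
  have h1 : ∀ x, Real.exp (u t x) * Real.exp (-u t x) = 1 := fun x => by
    rw [← Real.exp_add]; simp
  rcases hflow with h | ⟨h, hvol⟩
  · refine integral_congr_ae (Eventually.of_forall fun x => ?_)
    simp only
    rw [(h.1 t ht x).derivWithin (hJ t ht)]
    linear_combination -(Real.exp (-u t x) * (laplacian g (u t) x - R₀ +
      (1 / 2) * Real.exp (-u t x) * normSq g (A t).curvature x) ^ 2) * h1 x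
  · have hz := integral_exp_mul_derivWithin_eq_zero hg hJc hJ h0 hu hA h hvol ht
    set κ := (∫ y, Real.exp (-u t y) * normSq g (A t).curvature y ∂riemVolume g) /
          ∫ y, Real.exp (u t y) ∂riemVolume g with hκ
    have cv : Continuous fun x => derivWithin (fun s => u s x) J t :=
      (hu.derivWithin hJ isOpen_univ).continuous ht
    have cE : Continuous fun x => Real.exp (u t x) :=
      Real.continuous_exp.comp (hu.continuous ht)
    have i1 : Integrable (fun x => Real.exp (u t x) * (derivWithin (fun s => u s x) J t) ^ 2)
      (riemVolume g) := integrable_of_continuous (cE.mul (cv.pow 2))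
    have i2 : Integrable (fun x => Real.exp (u t x) * derivWithin (fun s => u s x) J t)
      (riemVolume g) := integrable_of_continuous (cE.mul cv)
    have e : ∀ x, derivWithin (fun s => u s x) J t * (laplacian g (u t) x - R₀ +
        (1 / 2) * (Real.exp (-u t x) * normSq g (A t).curvature x)) =
        Real.exp (u t x) * (derivWithin (fun s => u s x) J t) ^ 2 -
          (R₀ - κ / 2) * (Real.exp (u t x) * derivWithin (fun s => u s x) J t) := by
      intro x
      have h2 : Real.exp (-2 * u t x) = Real.exp (-u t x) * Real.exp (-u t x) := by
        rw [← Real.exp_add]; congr 1; ring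
      have h3 := (h.1 t ht x).derivWithin (hJ t ht)
      rw [h2, ← hκ] at h3
      set d := derivWithin (fun s => u s x) J t
      linear_combination (-d * (laplacian g (u t) x - R₀ +
        (1 / 2) * (Real.exp (-u t x) * normSq g (A t).curvature x))) * h1 x -
        (Real.exp (u t x) * d) * h3
    simp only [e]
    rw [integral_sub i1 (i2.const_mul _), integral_const_mul, hz, mul_zero, sub_zero]

end Energy

end RYM

end

theorem mainTheorem4 {ι M : Type*} [TopologicalSpace M]
    [ChartedSpace (EuclideanSpace ℝ (Fin 2)) M] [IsManifold (𝓡 2) ∞ M]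
    [T2Space M] [CompactSpace M] [MeasurableSpace M] [BorelSpace M]
    (g : ContMDiffRiemannianMetric (𝓡 2) ∞ (EuclideanSpace ℝ (Fin 2))
      (fun x : M => TangentSpace (𝓡 2) x))
    (g₀ : RYM.TensorField₂ M) (hg₀ : g₀ = RYM.ofMetric g)
    (R₀ : ℝ) (hcurv : ∀ x, RYM.scalarCurvature g₀ x = R₀)
    (hvol : RYM.riemVolume g₀ univ = 1)
    (L : RYM.U1Bundle ι M)
    (J : Set ℝ) (hJ : J.OrdConnected) (hJnt : J.Nontrivial) (hJ0 : IsLeast J 0)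
    (u : ℝ → M → ℝ) (A : ℝ → RYM.Connection L)
    (hu : ContMDiffOn (𝓘(ℝ, ℝ).prod (𝓡 2)) 𝓘(ℝ, ℝ) ∞ (fun p : ℝ × M => u p.1 p.2)
      (J ×ˢ univ))
    (hA : RYM.SmoothFamily J A)
    (hflow : RYM.IsConformalRYMFlow g₀ R₀ J u A ∨
      (RYM.IsVolumeNormalizedRYMFlow g₀ R₀ J u A ∧
        (R₀ ≠ 0 → (∫ x, Real.exp (u 0 x) ∂(RYM.riemVolume g₀)) = 1))) :
    (∀ t ∈ J, HasDerivWithinAt (fun s => RYM.energy g₀ R₀ (u s) (A s))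
      (-2 * (∫ x, Real.exp (u t x) * (derivWithin (fun s => u s x) J t) ^ 2
          ∂(RYM.riemVolume g₀)) -
        2 * ∫ x, RYM.nablaNormSq (RYM.conformal (u t) g₀) (A t).curvature x
          ∂(RYM.riemVolume (RYM.conformal (u t) g₀))) J t) ∧
    AntitoneOn (fun t => RYM.energy g₀ R₀ (u t) (A t)) J := by
  have hg : RYM.IsSmoothMetric g₀ := hg₀ ▸ RYM.isSmoothMetric_ofMetric g
  have : IsProbabilityMeasure (RYM.riemVolume g₀) := ⟨hvol⟩
  have hJi : (interior J).Nonempty := by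
    obtain ⟨a, ha, b, hb, hab⟩ := hJnt.exists_lt
    exact ⟨(a + b) / 2, interior_mono (hJ.out ha hb) (by
      rw [interior_Icc]; constructor <;> linarith)⟩
  have hJu : UniqueDiffOn ℝ J := uniqueDiffOn_convex hJ.convex hJi
  have hJ' : J ⊆ closure (interior J) := by
    rw [hJ.convex.closure_interior_eq_closure_of_nonempty_interior (𝕜 := ℝ) hJi]
    exact subset_closure
  have hd := fun t (ht : t ∈ J) => RYM.hasDerivWithinAt_energy_of_flow hg hJ hJu hJ' hJ0.1
    hu hA hflow ht
  refine ⟨hd, antitoneOn_of_deriv_nonpos hJ.convex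
    (fun t ht => (hd t ht).continuousWithinAt)
    (fun t ht => ((hd t (interior_subset ht)).hasDerivAt
      (mem_interior_iff_mem_nhds.1 ht)).differentiableAt.differentiableWithinAt)
    (fun t ht => ?_)⟩
  have htJ := interior_subset ht
  rw [((hd t htJ).hasDerivAt (mem_interior_iff_mem_nhds.1 ht)).deriv]
  have h1 : 0 ≤ ∫ x, Real.exp (u t x) * (derivWithin (fun s => u s x) J t) ^ 2
      ∂(RYM.riemVolume g₀) :=
    integral_nonneg fun x => mul_nonneg (Real.exp_pos _).le (sq_nonneg _)
  have h2 : 0 ≤ ∫ x, RYM.nablaNormSq (RYM.conformal (u t) g₀) (A t).curvature x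
      ∂(RYM.riemVolume (RYM.conformal (u t) g₀)) :=
    integral_nonneg fun x => (A t).isTwoForm_curvature.nablaNormSq_nonneg
      (hg.conformal (RYM.JointSmooth.contMDiff hu htJ)) x
  linarith
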